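/- Let $K$ be a complete discrete valuation field of characteristic $0$ with valuation ring $\mathcal O_K$, normalized valuation $v_K$, maximal ideal $\mathfrak m_K$, and perfect residue field $k$ of characteristic $p>0$; fix a uniformizer $\pi$. All formal groups are commutative, one-dimensional and defined over $\mathcal O_K$. For a formal group $F$, let $F(K)$ be the set $\mathfrak m_K$ with the addition $x+y:=F(x,y)$, and for $m\ge 1$ let $F^m(K)\subset F(K)$ be the subgroup with underlying set $\mathfrak m_K^m$; define $F(\bar K)$ in the same way with the maximal ideal of $\mathcal O_{\bar K}$. A homomorphism $\phi:F\to G$ is a power series $\phi(T)=a_1T+a_2T^2+\cdots\in\mathcal O_K[[T]]$ with $\phi(F(X,Y))=G(\phi(X),\phi(Y))$; put $D(\phi):=a_1$. It is an isogeny of height $h\geq 1$ if $\phi(T)\equiv\psi(T^{p^h})\pmod{\mathfrak m_K}$ for some $\psi\in\mathcal O_K[[T]]$ with $v_K(D(\psi))=0$, where $D(\psi)$ is the coefficient of $T$ in $\psi$. Let $F[\phi]$ be the kernel of $F(\bar K)\to G(\bar K)$, let $G(\phi):=G(K)/\phi F(K)$, let $G^m(\phi)$ be the image of $G^m(K)$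 in $G(\phi)$, and let $\mathrm{gr}^m(\phi):=G^m(\phi)/G^{m+1}(\phi)$. Let $n\ge 1$ and let $\phi=\phi_1\circ\cdots\circ\phi_n:F\to G$ be an isogeny, where $F=G_n$, $G=G_0$ and each $\phi_i:G_i\to G_{i-1}$ is an isogeny of height $1$ (so $\phi$ has height $n$). Assume that $F[\phi]$ is cyclic and $F[\phi]\subset F(K)$. (Then necessarily $G_i=F/p^iF[\phi]$.) Put $t_0:=0$, $t_i:=v_K(D(\phi_i))$ for $1\le i\le n$, and $c_i(\phi):=t_0+t_1+\cdots+t_i+t_i/(p-1)$ for $0\le i\le n$. Below, $\simeq$ denotes isomorphism of abelian groups. (i) If $c_i(\phi)<m<c_{i+1}(\phi)$ for some $0\le i<n$, then $$\mathrm{gr}^m(\phi)\simeq \mathrm{gr}^{m-(t_1+\cdots+t_i)}(\phi_{i+1}\circ\cdots\circ\phi_n)\simeq\begin{cases}k,&p^{n-i}\nmid m,\\0,&p^{n-i}\mid m.\end{cases}$$ (ii) For $0\le i<n$, the numbers $c_{i+1}(\phi)$ and $pt_{i+1}/(p-1)$ are integers and $$\mathrm{gr}^{c_{i+1}(\phi)}(\phi)\simeq\mathrm{gr}^{pt_{i+1}/(p-1)}(\phi_{i+1}\circ\cdots\circ\phi_n)\simeq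 k/(a+\bar a_pC^{-1})k,$$ where $a\in k$ is the residue class of $D(\phi_{i+1})\pi^{-t_{i+1}}$, $\bar a_p\in k$ is the residue class of the coefficient of $T^p$ in $\phi_{i+1}$, and $a+\bar a_pC^{-1}:k\to k$ is the map $x\mapsto ax+\bar a_px^p$. If $k$ is separably closed, then $\mathrm{gr}^{c_{i+1}(\phi)}(\phi)=0$. If $k$ is quasi-finite (i.e. perfect with absolute Galois group isomorphic to $\widehat{\mathbb Z}$), then $\mathrm{gr}^{c_{i+1}(\phi)}(\phi)\simeq\mathbb Z/p\mathbb Z$. (iii) If $m>c_n(\phi)$, then $G^m(\phi)=0$; in particular $\mathrm{gr}^m(\phi)=0$. -/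

import Mathlib

open IsLocalRing

noncomputable section

/-! ### Evaluation of power series on the maximal ideal of a complete local ring -/

section Evaluation

variable {O : Type*} [CommRing O] [IsLocalRing O]

/-- The value `f(a)` of a power series in several variables over a local ring `O`: the sum of the
series `∑ f_d a^d` for the `𝔪`-adic topology of `O`. -/
def mvEval {σ : Type*} (a : σ → O) (f : MvPowerSeries σ O) : O :=
  letI : TopologicalSpace O := (maximalIdeal O).adicTopology
  ∑' d : σ →₀ ℕ, MvPowerSeries.coeff d f * d.prod fun s e => a s ^ e

/-- The value `f(x)` of a power series in one variable over a local ring `O`: the sum of the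
series `∑ f_d x^d` for the `𝔪`-adic topology of `O`. -/
def psEval (x : O) (f : PowerSeries O) : O :=
  letI : TopologicalSpace O := (maximalIdeal O).adicTopology
  ∑' d : ℕ, PowerSeries.coeff d f * x ^ d

/-- Auxiliary: Mathlib's evaluation of power series, with discrete coefficients and values in
`O` with its `𝔪`-adic topology. -/
def mvEvalAux {σ : Type*} (a : σ → O) (f : MvPowerSeries σ O) : O :=
  letI : WithIdeal O := ⟨maximalIdeal O⟩
  @MvPowerSeries.eval₂ σ O _ ⊥ O _ _ (algebraMap O O) a f

theorem adic_hasEval {σ : Type*} [Finite σ] {a : σ → O} (ha : ∀ s, a s ∈ maximalIdeal O) :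
    letI : WithIdeal O := ⟨maximalIdeal O⟩
    MvPowerSeries.HasEval a := by
  letI : WithIdeal O := ⟨maximalIdeal O⟩
  exact ⟨fun s => WithIdeal.isTopologicallyNilpotent_of_mem (ha s), by simp⟩

variable [IsAdicComplete (maximalIdeal O) O]

theorem adic_complete_t2 :
    letI : WithIdeal O := ⟨maximalIdeal O⟩
    CompleteSpace O ∧ T2Space O := by
  letI : WithIdeal O := ⟨maximalIdeal O⟩
  exact (IsAdic.isAdicComplete_iff (I := maximalIdeal O) rfl).1 inferInstance

theorem hasSum_mvEvalAux {σ : Type*} [Finite σ] {a : σ → O} (ha : ∀ s, a s ∈ maximalIdeal O)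
    (f : MvPowerSeries σ O) :
    letI : TopologicalSpace O := (maximalIdeal O).adicTopology
    HasSum (fun d : σ →₀ ℕ => MvPowerSeries.coeff d f * d.prod fun s e => a s ^ e)
      (mvEvalAux a f) := by
  letI : WithIdeal O := ⟨maximalIdeal O⟩
  obtain ⟨h1, h2⟩ := adic_complete_t2 (O := O)
  have ht : @IsTopologicalSemiring O (⊥ : UniformSpace O).toTopologicalSpace _ := by
    letI : UniformSpace O := ⊥
    infer_instance
  have hu : @IsUniformAddGroup O ⊥ _ := by
    letI : UniformSpace O := ⊥
    infer_instance
  exact @MvPowerSeries.hasSum_eval₂ σ O _ ⊥ O _ _ (algebraMap O O) a ht hu _ h1 h2 _ _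
    continuous_bot (adic_hasEval ha) f

theorem hasSum_mvEval {σ : Type*} [Finite σ] {a : σ → O} (ha : ∀ s, a s ∈ maximalIdeal O)
    (f : MvPowerSeries σ O) :
    letI : TopologicalSpace O := (maximalIdeal O).adicTopology
    HasSum (fun d : σ →₀ ℕ => MvPowerSeries.coeff d f * d.prod fun s e => a s ^ e)
      (mvEval a f) := by
  letI : WithIdeal O := ⟨maximalIdeal O⟩
  exact (hasSum_mvEvalAux ha f).summable.hasSum

theorem mvEval_eq_aux {σ : Type*} [Finite σ] {a : σ → O} (ha : ∀ s, a s ∈ maximalIdeal O)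
    (f : MvPowerSeries σ O) : mvEval a f = mvEvalAux a f := by
  letI : WithIdeal O := ⟨maximalIdeal O⟩
  obtain ⟨h1, h2⟩ := adic_complete_t2 (O := O)
  exact (hasSum_mvEval ha f).unique (hasSum_mvEvalAux ha f)

theorem psEval_eq_mvEval {x : O} (hx : x ∈ maximalIdeal O) (f : PowerSeries O) :
    psEval x f = mvEval (fun _ : Unit => x) f := by
  letI : WithIdeal O := ⟨maximalIdeal O⟩
  obtain ⟨h1, h2⟩ := adic_complete_t2 (O := O)
  have h := hasSum_mvEval (a := fun _ : Unit => x) (fun _ => hx) f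
  rw [← (Finsupp.single_injective ()).hasSum_iff] at h
  · refine HasSum.tsum_eq ?_
    convert h using 2 with d
    simp [PowerSeries.coeff]
  · intro d hd
    exact False.elim (hd ⟨d (), by ext; simp⟩)

theorem isClosed_pow_maximalIdeal (N : ℕ) :
    letI : TopologicalSpace O := (maximalIdeal O).adicTopology
    IsClosed ((maximalIdeal O ^ N : Ideal O) : Set O) := by
  letI : WithIdeal O := ⟨maximalIdeal O⟩
  exact (Ideal.openAddSubgroup (maximalIdeal O) N).isClosed

theorem hasSum_mem_pow {ι : Type*} {N : ℕ} {g : ι → O} {y : O}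
    (h : letI : TopologicalSpace O := (maximalIdeal O).adicTopology; HasSum g y)
    (hg : ∀ i, g i ∈ maximalIdeal O ^ N) : y ∈ maximalIdeal O ^ N := by
  letI : WithIdeal O := ⟨maximalIdeal O⟩
  exact (isClosed_pow_maximalIdeal N).mem_of_tendsto h
    (Filter.Eventually.of_forall fun s => Ideal.sum_mem _ fun i _ => hg i)

theorem mvEval_mem {σ : Type*} [Finite σ] {a : σ → O} {N : ℕ} (hN : N ≠ 0)
    (ha : ∀ s, a s ∈ maximalIdeal O ^ N)
    {f : MvPowerSeries σ O} (hf : MvPowerSeries.constantCoeff f = 0) :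
    mvEval a f ∈ maximalIdeal O ^ N := by
  refine hasSum_mem_pow (hasSum_mvEval (fun s => Ideal.pow_le_self hN (ha s)) f) fun d => ?_
  by_cases hd : d = 0
  · subst hd
    have : MvPowerSeries.coeff 0 f = 0 := by simpa using hf
    simp [this]
  · obtain ⟨i, hi⟩ := Finsupp.support_nonempty_iff.mpr hd
    refine Ideal.mul_mem_left _ _ (Ideal.prod_mem _ hi ?_)
    exact Ideal.pow_mem_of_mem _ (ha i) _ (Nat.pos_of_ne_zero (Finsupp.mem_support_iff.mp hi))

theorem psEval_mem {x : O} {N : ℕ} (hN : N ≠ 0) (hx : x ∈ maximalIdeal O ^ N)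
    {f : PowerSeries O} (hf : PowerSeries.constantCoeff f = 0) :
    psEval x f ∈ maximalIdeal O ^ N := by
  rw [psEval_eq_mvEval (Ideal.pow_le_self hN hx)]
  exact mvEval_mem hN (fun _ => hx) hf

theorem mvEval_X {σ : Type*} [Finite σ] {a : σ → O} (ha : ∀ s, a s ∈ maximalIdeal O) (s : σ) :
    mvEval a (MvPowerSeries.X s) = a s := by
  rw [mvEval_eq_aux ha]
  letI : WithIdeal O := ⟨maximalIdeal O⟩
  exact @MvPowerSeries.eval₂_X σ O _ ⊥ O _ _ _ a s

theorem mvEval_zero {σ : Type*} (a : σ → O) : mvEval a 0 = 0 := by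
  simp [mvEval]

theorem mvEval_subst {σ τ : Type*} [Finite σ] [Finite τ] {a : σ → MvPowerSeries τ O} {b : τ → O}
    (ha : ∀ s, MvPowerSeries.constantCoeff (a s) = 0) (hb : ∀ t, b t ∈ maximalIdeal O)
    (f : MvPowerSeries σ O) :
    mvEval b (MvPowerSeries.subst a f) = mvEval (fun s => mvEval b (a s)) f := by
  have hab : ∀ s, mvEval b (a s) ∈ maximalIdeal O := fun s => by
    have := mvEval_mem (N := 1) one_ne_zero (by simpa using hb) (ha s)
    simpa using this
  rw [mvEval_eq_aux hb, mvEval_eq_aux hab]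
  simp_rw [mvEval_eq_aux hb]
  letI : WithIdeal O := ⟨maximalIdeal O⟩
  obtain ⟨h1, h2⟩ := adic_complete_t2 (O := O)
  have hdu : @DiscreteUniformity O ⊥ := @DiscreteUniformity.mk O ⊥ rfl
  exact @MvPowerSeries.eval₂_subst σ O _ τ O _ _ a O _ _ h2 h1 _ _ _ _ _ _ ⊥ hdu ⊥ hdu
    (MvPowerSeries.hasSubst_of_constantCoeff_zero ha) b (adic_hasEval hb) f

end Evaluation

/-! ### Points of a formal group -/

namespace FormalGroup

section Points

variable {O : Type*} [CommRing O] [IsLocalRing O] [IsAdicComplete (maximalIdeal O) O]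

/-- `F(K)`: the maximal ideal of `O = O_K`, to be equipped with the addition `x + y := F(x, y)`. -/
@[ext]
structure Points (F : FormalGroup O) where
  /-- The underlying element of `O`. -/
  val : O
  mem : val ∈ maximalIdeal O

theorem pair_mem {x y : O} {I : Ideal O} (hx : x ∈ I) (hy : y ∈ I) (s : Fin 2) : ![x, y] s ∈ I := by
  fin_cases s
  · exact hx
  · exact hy

theorem mvEval_pair_mem (F : FormalGroup O) {x y : O} {N : ℕ} (hN : N ≠ 0)
    (hx : x ∈ maximalIdeal O ^ N) (hy : y ∈ maximalIdeal O ^ N) :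
    mvEval ![x, y] F.toPowerSeries ∈ maximalIdeal O ^ N :=
  mvEval_mem hN (pair_mem hx hy) F.zero_constantCoeff

theorem mvEval_pair_mem_max (F : FormalGroup O) {x y : O}
    (hx : x ∈ maximalIdeal O) (hy : y ∈ maximalIdeal O) :
    mvEval ![x, y] F.toPowerSeries ∈ maximalIdeal O := by
  simpa using F.mvEval_pair_mem one_ne_zero (by simpa using hx) (by simpa using hy)

/-- Evaluation of `F(a, b)` for power series `a`, `b` without constant term. -/
theorem mvEval_subst_pair {τ : Type*} [Finite τ] (f : MvPowerSeries (Fin 2) O)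
    {a b : MvPowerSeries τ O} (ha : MvPowerSeries.constantCoeff a = 0)
    (hb : MvPowerSeries.constantCoeff b = 0) {c : τ → O} (hc : ∀ t, c t ∈ maximalIdeal O) :
    mvEval c (MvPowerSeries.subst ![a, b] f) = mvEval ![mvEval c a, mvEval c b] f := by
  rw [mvEval_subst _ hc]
  · congr 1
    funext s
    fin_cases s <;> rfl
  · intro s
    fin_cases s
    · exact ha
    · exact hb

instance (F : FormalGroup O) : Zero F.Points := ⟨⟨0, zero_mem _⟩⟩

instance (F : FormalGroup O) : Add F.Points :=
  ⟨fun x y => ⟨mvEval ![x.val, y.val] F.toPowerSeries, F.mvEval_pair_mem_max x.mem y.mem⟩⟩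

theorem Points.val_zero (F : FormalGroup O) : (0 : F.Points).val = 0 := rfl

theorem Points.val_add {F : FormalGroup O} (x y : F.Points) :
    (x + y).val = mvEval ![x.val, y.val] F.toPowerSeries := rfl

theorem constantCoeff_subst_pair_X (F : FormalGroup O) {τ : Type*} (i j : τ) :
    MvPowerSeries.constantCoeff
      (MvPowerSeries.subst ![(MvPowerSeries.X i : MvPowerSeries τ O), MvPowerSeries.X j]
        F.toPowerSeries) = 0 :=
  MvPowerSeries.constantCoeff_subst_eq_zero MvPowerSeries.HasSubst.X_X
    (fun s => by fin_cases s <;> simp) F.zero_constantCoeff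

theorem Points.add_assoc' {F : FormalGroup O} (x y z : F.Points) : x + y + z = x + (y + z) := by
  have hc : ∀ t, ![x.val, y.val, z.val] t ∈ maximalIdeal O := fun t => by
    fin_cases t
    · exact x.mem
    · exact y.mem
    · exact z.mem
  have h := congrArg (mvEval ![x.val, y.val, z.val]) F.assoc
  rw [mvEval_subst_pair _ (F.constantCoeff_subst_pair_X _ _) (MvPowerSeries.constantCoeff_X _) hc,
    mvEval_subst_pair _ (MvPowerSeries.constantCoeff_X _) (F.constantCoeff_subst_pair_X _ _) hc,
    mvEval_subst_pair _ (MvPowerSeries.constantCoeff_X _) (MvPowerSeries.constantCoeff_X _) hc,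
    mvEval_subst_pair _ (MvPowerSeries.constantCoeff_X _) (MvPowerSeries.constantCoeff_X _) hc,
    mvEval_X hc, mvEval_X hc, mvEval_X hc] at h
  exact Points.ext h

theorem mvEval_right_zero (F : FormalGroup O) {x : O} (hx : x ∈ maximalIdeal O) :
    mvEval ![x, 0] F.toPowerSeries = x := by
  have hc : ∀ _ : Unit, x ∈ maximalIdeal O := fun _ => hx
  have h := congrArg (mvEval fun _ : Unit => x) F.Xzero_eq_X
  rw [Xzero, PowerSeries.X,
    mvEval_subst_pair _ (MvPowerSeries.constantCoeff_X _) (map_zero _) hc,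
    mvEval_X hc, mvEval_zero] at h
  exact h

theorem Points.add_zero' {F : FormalGroup O} (x : F.Points) : x + 0 = x :=
  Points.ext (F.mvEval_right_zero x.mem)

theorem Points.add_comm' {F : FormalGroup O} [F.IsComm] (x y : F.Points) : x + y = y + x := by
  have hc := pair_mem x.mem y.mem
  have h := congrArg (mvEval ![x.val, y.val]) (IsComm.comm (F := F))
  rw [mvEval_subst_pair _ (MvPowerSeries.constantCoeff_X _) (MvPowerSeries.constantCoeff_X _) hc,
    mvEval_X hc, mvEval_X hc] at h
  exact Points.ext h

theorem mvEval_sub_mem (F : FormalGroup O) {x y y' : O} {N : ℕ} (hx : x ∈ maximalIdeal O)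
    (hy : y ∈ maximalIdeal O) (hy' : y' ∈ maximalIdeal O) (h : y - y' ∈ maximalIdeal O ^ N) :
    mvEval ![x, y] F.toPowerSeries - mvEval ![x, y'] F.toPowerSeries - (y - y') ∈
      maximalIdeal O ^ (N + 1) := by
  classical
  letI : WithIdeal O := ⟨maximalIdeal O⟩
  have h1 := hasSum_mvEval (pair_mem hx hy) F.toPowerSeries
  have h2 := hasSum_mvEval (pair_mem hx hy') F.toPowerSeries
  have h3 : HasSum (fun d : Fin 2 →₀ ℕ => if d = Finsupp.single 1 1 then y - y' else 0) (y - y') :=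
    hasSum_ite_eq _ _
  refine hasSum_mem_pow ((h1.sub h2).sub h3) fun d => ?_
  have hprod : ∀ z : O, (d.prod fun s e => ![x, z] s ^ e) = x ^ d 0 * z ^ d 1 := fun z => by
    rw [Finsupp.prod_fintype _ _ (fun _ => pow_zero _), Fin.prod_univ_two]
    rfl
  obtain ⟨q, hq⟩ := sub_dvd_pow_sub_pow y y' (d 1)
  by_cases hd : d = Finsupp.single 1 1
  · subst hd
    simp [F.lin_coeff_Y, Finsupp.prod_single_index]
  · simp only [hprod, if_neg hd, sub_zero, ← mul_sub]
    refine Ideal.mul_mem_left _ _ ?_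
    by_cases h0 : d 0 = 0
    · rw [h0, pow_zero, one_mul]
      by_cases h10 : d 1 = 0
      · simp [h10]
      have h11 : d 1 ≠ 1 := fun h11 => hd (by
        ext s
        fin_cases s
        · simpa using h0
        · simpa using h11)
      rw [← geom_sum₂_mul, pow_succ']
      refine Ideal.mul_mem_mul (Ideal.sum_mem _ fun i hi => ?_) h
      by_cases hi0 : i = 0
      · exact Ideal.mul_mem_left _ _ (Ideal.pow_mem_of_mem _ hy' _ (by omega))
      · exact Ideal.mul_mem_right _ _ (Ideal.pow_mem_of_mem _ hy _ (by omega))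
    · rw [pow_succ']
      refine Ideal.mul_mem_mul (Ideal.pow_mem_of_mem _ hx _ (Nat.pos_of_ne_zero h0)) ?_
      rw [hq]
      exact Ideal.mul_mem_right _ _ h

theorem exists_right_neg (F : FormalGroup O) {x : O} (hx : x ∈ maximalIdeal O) :
    ∃ y ∈ maximalIdeal O, mvEval ![x, y] F.toPowerSeries = 0 := by
  let u : ℕ → O := fun k => Nat.rec 0 (fun _ y => y - mvEval ![x, y] F.toPowerSeries) k
  have hu : ∀ k, u (k + 1) = u k - mvEval ![x, u k] F.toPowerSeries := fun k => rfl
  have hm : ∀ k, u k ∈ maximalIdeal O := fun k => by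
    induction k with
    | zero => exact zero_mem _
    | succ k ih => rw [hu]; exact sub_mem ih (F.mvEval_pair_mem_max hx ih)
  have hF : ∀ k, mvEval ![x, u k] F.toPowerSeries ∈ maximalIdeal O ^ (k + 1) := fun k => by
    induction k with
    | zero => simpa using F.mvEval_pair_mem_max hx (hm 0)
    | succ k ih =>
      have h := F.mvEval_sub_mem (N := k + 1) hx (hm (k + 1)) (hm k)
        (by rw [hu]; simpa using ih)
      have e : u (k + 1) - u k = - mvEval ![x, u k] F.toPowerSeries := by rw [hu]; ring
      rw [e] at h
      simpa using h
  have hstep : ∀ k, u k - u (k + 1) ∈ maximalIdeal O ^ k := fun k => by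
    rw [hu, sub_sub_cancel]
    exact Ideal.pow_le_pow_right (Nat.le_succ k) (hF k)
  have hcau : ∀ {m n : ℕ}, m ≤ n → u m ≡ u n [SMOD (maximalIdeal O ^ m • ⊤ : Submodule O O)] := by
    intro m n hmn
    rw [SModEq.sub_mem, smul_eq_mul, Ideal.mul_top]
    induction n, hmn using Nat.le_induction with
    | base => simp
    | succ n hmn ih =>
      have := Ideal.add_mem _ ih (Ideal.pow_le_pow_right hmn (hstep n))
      simpa using this
  obtain ⟨y, hy⟩ := IsPrecomplete.prec (I := maximalIdeal O) inferInstance hcau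
  simp only [SModEq.sub_mem, smul_eq_mul, Ideal.mul_top] at hy
  have hym : y ∈ maximalIdeal O := by
    have := sub_mem (hm 1) (by simpa using hy 1)
    simpa using this
  refine ⟨y, hym, IsHausdorff.haus (I := maximalIdeal O) inferInstance _ fun k => ?_⟩
  rw [SModEq.sub_mem, smul_eq_mul, Ideal.mul_top, sub_zero]
  have h1 := Ideal.pow_le_pow_right (Nat.le_succ k) (F.mvEval_sub_mem hx (hm k) hym (hy k))
  have h2 := Ideal.pow_le_pow_right (Nat.le_succ k) (hF k)
  have h3 := sub_mem (sub_mem h2 h1) (hy k)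
  convert h3 using 1
  ring

instance (F : FormalGroup O) : Neg F.Points :=
  ⟨fun x => ⟨(F.exists_right_neg x.mem).choose, (F.exists_right_neg x.mem).choose_spec.1⟩⟩

theorem Points.add_neg' {F : FormalGroup O} (x : F.Points) : x + -x = 0 :=
  Points.ext (F.exists_right_neg x.mem).choose_spec.2

/-- The group `F(K)`, for a commutative formal group `F` over `O = O_K`. -/
instance (F : FormalGroup O) [F.IsComm] : AddCommGroup F.Points where
  add_assoc := Points.add_assoc'
  zero_add x := by rw [Points.add_comm', Points.add_zero']
  add_zero := Points.add_zero'
  neg_add_cancel x := by rw [Points.add_comm', Points.add_neg']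
  add_comm := Points.add_comm'
  nsmul := nsmulRec
  zsmul := zsmulRec

theorem neg_mem_pow {F : FormalGroup O} {N : ℕ} (x : F.Points)
    (hx : x.val ∈ maximalIdeal O ^ N) : (-x).val ∈ maximalIdeal O ^ N := by
  suffices h : ∀ k ≤ N, (-x).val ∈ maximalIdeal O ^ k from h N le_rfl
  intro k
  induction k with
  | zero => simp
  | succ k ih =>
    intro hk
    have h := F.mvEval_sub_mem (N := k) x.mem (-x).mem (zero_mem _) (by simpa using ih (by omega))
    have h0 : mvEval ![x.val, (-x).val] F.toPowerSeries = 0 := congrArg Points.val (Points.add_neg' x)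
    rw [h0, F.mvEval_right_zero x.mem] at h
    have := neg_mem (add_mem h (Ideal.pow_le_pow_right hk hx))
    simpa using this

/-- `F^m(K)`: the subgroup of `F(K)` consisting of the set `𝔪^m`. -/
def fil (F : FormalGroup O) [F.IsComm] (m : ℕ) : AddSubgroup F.Points where
  carrier := {x | x.val ∈ maximalIdeal O ^ m}
  zero_mem' := zero_mem (maximalIdeal O ^ m)
  add_mem' {x y} hx hy := by
    rcases Nat.eq_zero_or_pos m with rfl | hm
    · simp
    · exact F.mvEval_pair_mem hm.ne' hx hy
  neg_mem' {x} hx := neg_mem_pow x hx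

end Points

/-! ### Homomorphisms of formal groups -/

section Hom

/-- A homomorphism `F → G` of formal groups over `R`: a power series `φ(T)` without constant term
such that `φ(F(X, Y)) = G(φ(X), φ(Y))`. -/
@[ext]
structure Hom {R : Type*} [CommRing R] (F G : FormalGroup R) where
  /-- The underlying power series `φ(T)`. -/
  series : PowerSeries R
  constantCoeff_series : PowerSeries.constantCoeff series = 0
  map_add' : PowerSeries.subst F.toPowerSeries series =
    MvPowerSeries.subst ![PowerSeries.subst (MvPowerSeries.X (0 : Fin 2) : MvPowerSeries (Fin 2) R)
        series,
      PowerSeries.subst (MvPowerSeries.X (1 : Fin 2) : MvPowerSeries (Fin 2) R) series]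
      G.toPowerSeries

namespace Hom

variable {R : Type*} [CommRing R] {F G H : FormalGroup R}

theorem subst_psSubst {σ τ : Type*} {a : MvPowerSeries σ R} {b : σ → MvPowerSeries τ R}
    (ha : PowerSeries.HasSubst a) (hb : MvPowerSeries.HasSubst b) (f : PowerSeries R) :
    MvPowerSeries.subst b (PowerSeries.subst a f) =
      PowerSeries.subst (MvPowerSeries.subst b a) f :=
  MvPowerSeries.subst_comp_subst_apply ha.const hb f

/-- The identity homomorphism `T`. -/
protected def id (F : FormalGroup R) : Hom F F where
  series := PowerSeries.X
  constantCoeff_series := by simp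
  map_add' := by
    rw [PowerSeries.subst_X (.of_constantCoeff_zero F.zero_constantCoeff),
      PowerSeries.subst_X (.X _), PowerSeries.subst_X (.X _)]
    have : (![MvPowerSeries.X 0, MvPowerSeries.X 1] : Fin 2 → MvPowerSeries (Fin 2) R) =
        MvPowerSeries.X := by
      funext s
      fin_cases s <;> rfl
    rw [this, ← MvPowerSeries.map_algebraMap_eq_subst_X]
    simp

/-- The composite `φ ∘ ψ`, with power series `φ(ψ(T))`. -/
def comp (φ : Hom G H) (ψ : Hom F G) : Hom F H where
  series := PowerSeries.subst ψ.series φ.series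
  constantCoeff_series :=
    PowerSeries.constantCoeff_subst_eq_zero ψ.constantCoeff_series _ φ.constantCoeff_series
  map_add' := by
    have hψ : PowerSeries.HasSubst ψ.series := .of_constantCoeff_zero' ψ.constantCoeff_series
    have hF : PowerSeries.HasSubst F.toPowerSeries := .of_constantCoeff_zero F.zero_constantCoeff
    have hG : PowerSeries.HasSubst G.toPowerSeries := .of_constantCoeff_zero G.zero_constantCoeff
    have hz : ∀ i : Fin 2, MvPowerSeries.constantCoeff (PowerSeries.subst
        (MvPowerSeries.X i : MvPowerSeries (Fin 2) R) ψ.series) = 0 := fun i =>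
      PowerSeries.constantCoeff_subst_eq_zero (by simp) _ ψ.constantCoeff_series
    have hz' : ∀ i : Fin 2, MvPowerSeries.constantCoeff (PowerSeries.subst
        (MvPowerSeries.X i : MvPowerSeries (Fin 2) R) φ.series) = 0 := fun i =>
      PowerSeries.constantCoeff_subst_eq_zero (by simp) _ φ.constantCoeff_series
    have hp : MvPowerSeries.HasSubst
        ![PowerSeries.subst (MvPowerSeries.X (0 : Fin 2) : MvPowerSeries (Fin 2) R) ψ.series,
          PowerSeries.subst (MvPowerSeries.X (1 : Fin 2) : MvPowerSeries (Fin 2) R) ψ.series] :=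
      MvPowerSeries.hasSubst_of_constantCoeff_zero fun s => by
        fin_cases s
        · exact hz 0
        · exact hz 1
    have hp' : MvPowerSeries.HasSubst
        ![PowerSeries.subst (MvPowerSeries.X (0 : Fin 2) : MvPowerSeries (Fin 2) R) φ.series,
          PowerSeries.subst (MvPowerSeries.X (1 : Fin 2) : MvPowerSeries (Fin 2) R) φ.series] :=
      MvPowerSeries.hasSubst_of_constantCoeff_zero fun s => by
        fin_cases s
        · exact hz' 0
        · exact hz' 1
    rw [PowerSeries.subst_comp_subst_apply hψ hF, ψ.map_add']
    have e := congrArg (MvPowerSeries.subst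
      ![PowerSeries.subst (MvPowerSeries.X (0 : Fin 2) : MvPowerSeries (Fin 2) R) ψ.series,
        PowerSeries.subst (MvPowerSeries.X (1 : Fin 2) : MvPowerSeries (Fin 2) R) ψ.series])
      φ.map_add'
    rw [subst_psSubst hG hp,
      MvPowerSeries.subst_comp_subst_apply hp' hp] at e
    refine e.trans ?_
    congr 1
    funext s
    have key : ∀ i : Fin 2, MvPowerSeries.subst
        ![PowerSeries.subst (MvPowerSeries.X (0 : Fin 2) : MvPowerSeries (Fin 2) R) ψ.series,
          PowerSeries.subst (MvPowerSeries.X (1 : Fin 2) : MvPowerSeries (Fin 2) R) ψ.series]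
        (PowerSeries.subst (MvPowerSeries.X i : MvPowerSeries (Fin 2) R) φ.series) =
        PowerSeries.subst (MvPowerSeries.X i : MvPowerSeries (Fin 2) R)
          (PowerSeries.subst ψ.series φ.series) := fun i => by
      rw [PowerSeries.subst_comp_subst_apply hψ (.X i), subst_psSubst (.X i) hp,
        MvPowerSeries.subst_X hp]
      fin_cases i <;> rfl
    fin_cases s
    · exact key 0
    · exact key 1

variable {O : Type*} [CommRing O] [IsLocalRing O] [IsAdicComplete (maximalIdeal O) O]
variable {F G : FormalGroup O}

/-- The homomorphism `F(K) → G(K)`, `x ↦ φ(x)`, induced by `φ : F → G`. -/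
def onPoints [F.IsComm] [G.IsComm] (φ : Hom F G) : F.Points →+ G.Points :=
  AddMonoidHom.mk'
    (fun x => ⟨psEval x.val φ.series, by
      simpa using psEval_mem one_ne_zero (by simpa using x.mem) φ.constantCoeff_series⟩)
    (fun x y => by
      have hc := pair_mem x.mem y.mem
      have hz : ∀ i : Fin 2, MvPowerSeries.constantCoeff (PowerSeries.subst
          (MvPowerSeries.X i : MvPowerSeries (Fin 2) O) φ.series) = 0 := fun i =>
        PowerSeries.constantCoeff_subst_eq_zero (by simp) _ φ.constantCoeff_series
      have h := congrArg (mvEval ![x.val, y.val]) φ.map_add'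
      rw [mvEval_subst_pair _ (hz 0) (hz 1) hc, PowerSeries.subst, PowerSeries.subst,
        PowerSeries.subst, mvEval_subst (fun _ => F.zero_constantCoeff) hc,
        mvEval_subst (fun _ => MvPowerSeries.constantCoeff_X _) hc,
        mvEval_subst (fun _ => MvPowerSeries.constantCoeff_X _) hc] at h
      simp only [mvEval_X hc] at h
      refine Points.ext ?_
      simp only [Points.val_add]
      rw [psEval_eq_mvEval x.mem, psEval_eq_mvEval y.mem,
        psEval_eq_mvEval (F.mvEval_pair_mem_max x.mem y.mem)]
      exact h)

/-- `G(φ) := G(K) / φ F(K)`. -/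
abbrev Coker [F.IsComm] [G.IsComm] (φ : Hom F G) : Type _ := G.Points ⧸ φ.onPoints.range

/-- `G^m(φ)`: the image of `G^m(K)` in `G(φ)`. -/
def cokerFil [F.IsComm] [G.IsComm] (φ : Hom F G) (m : ℕ) : AddSubgroup φ.Coker :=
  (G.fil m).map (QuotientAddGroup.mk' φ.onPoints.range)

/-- `gr^m(φ) := G^m(φ) / G^{m+1}(φ)`. -/
abbrev gr [F.IsComm] [G.IsComm] (φ : Hom F G) (m : ℕ) : Type _ :=
  φ.cokerFil m ⧸ (φ.cokerFil (m + 1)).addSubgroupOf (φ.cokerFil m)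

/-- `φ` has height `n`: there is a power series `ψ` whose linear coefficient is a unit such that
`φ(T) ≡ ψ(T^{p^n})` modulo the maximal ideal. -/
def HasHeight (φ : Hom F G) (p n : ℕ) : Prop :=
  ∃ ψ : PowerSeries O, IsUnit (PowerSeries.coeff 1 ψ) ∧
    PowerSeries.map (residue O) φ.series =
      PowerSeries.map (residue O) (PowerSeries.subst (PowerSeries.X ^ p ^ n : PowerSeries O) ψ)

/-- `D(φ)`: the coefficient of `T` in `φ(T)`. -/
def linCoeff (φ : Hom F G) : O := PowerSeries.coeff 1 φ.series

/-- The kernel of the map `F(K̄) → G(K̄)` induced by `φ`: the elements `x` of the maximal ideal of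
the valuation ring `O_K̄` such that `φ(x) = 0`. Here `O_K̄` is the integral closure of `O` in an
algebraic closure `K̄` of `K = Frac O` (for complete `O` it is the valuation ring of the unique
valuation of `K̄` extending that of `K`), its topology is given by the ideals `𝔪_K^N O_K̄`, and its
maximal ideal is the set of nonunits. -/
def geomKernel (K : Type*) [Field K] [Algebra O K] (φ : Hom F G) :
    Set (integralClosure O (AlgebraicClosure K)) :=
  {x | x ∈ nonunits (integralClosure O (AlgebraicClosure K)) ∧
    letI : TopologicalSpace (integralClosure O (AlgebraicClosure K)) :=
      ((maximalIdeal O).map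
        (algebraMap O (integralClosure O (AlgebraicClosure K)))).adicTopology
    HasSum (fun d : ℕ => PowerSeries.coeff d φ.series • x ^ d) 0}

/-- `F[φ] ⊆ F(K)`: every element of the kernel of `F(K̄) → G(K̄)` comes from `F(K) = 𝔪_K`. -/
def KernelRational (K : Type*) [Field K] [Algebra O K] (φ : Hom F G) : Prop :=
  ∀ x ∈ φ.geomKernel K, ∃ y ∈ maximalIdeal O,
    algebraMap O (integralClosure O (AlgebraicClosure K)) y = x

end Hom

end Hom

/-! ### Chains of isogenies `G_n → ⋯ → G_1 → G_0` -/

section Chain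

/-- For `φ_{i+1} = φ i : G_{i+1} → G_i` with `0 ≤ i < n`, the composite
`φ_{i+1} ∘ ⋯ ∘ φ_n : G_n → G_i`. -/
def chainComp {R : Type*} [CommRing R] {n : ℕ} {G : Fin (n + 1) → FormalGroup R}
    (φ : ∀ i : Fin n, Hom (G i.succ) (G i.castSucc)) (i : Fin (n + 1)) :
    Hom (G (Fin.last n)) (G i) :=
  Fin.reverseInduction (motive := fun i => Hom (G (Fin.last n)) (G i)) (Hom.id _)
    (fun i f => (φ i).comp f) i

variable {O : Type*} [CommRing O] [IsDomain O] [IsDiscreteValuationRing O]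

/-- `t_{i+1} := v_K(D(φ_{i+1}))`, where `φ_{i+1} = φ i`. -/
def chainT {n : ℕ} {G : Fin (n + 1) → FormalGroup O}
    (φ : ∀ i : Fin n, Hom (G i.succ) (G i.castSucc)) (i : Fin n) : ℕ :=
  (IsDiscreteValuationRing.addVal O (φ i).linCoeff).toNat

/-- `c_0 = 0` and `c_{i+1} = t_1 + ⋯ + t_{i+1} + t_{i+1} / (p - 1)`. -/
def chainC (p : ℕ) {n : ℕ} {G : Fin (n + 1) → FormalGroup O}
    (φ : ∀ i : Fin n, Hom (G i.succ) (G i.castSucc)) (i : Fin (n + 1)) : ℚ :=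
  Fin.cases 0
    (fun j => (∑ l ∈ Finset.Iic j, (chainT φ l : ℚ)) + (chainT φ j : ℚ) / ((p : ℚ) - 1)) i

end Chain

end FormalGroup

/-- The additive map `a + b C⁻¹ : x ↦ a x + b x ^ p` of a field `k` of characteristic `p`. -/
def addCartierInv {k : Type*} [Field k] (p : ℕ) [Fact p.Prime] [CharP k p] (a b : k) : k →+ k :=
  AddMonoidHom.mulLeft a + (AddMonoidHom.mulLeft b).comp (frobenius k p).toAddMonoidHom

/-- A field is quasi-finite if it is perfect and its absolute Galois group is isomorphic, as a
topological group, to the profinite completion of `ℤ`. -/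
def IsQuasiFiniteField (k : Type*) [Field k] : Prop :=
  PerfectField k ∧ Nonempty (Field.absoluteGaloisGroup k ≃ₜ*
    ProfiniteGrp.ProfiniteCompletion.completion (GrpCat.of (Multiplicative ℤ)))

end

/-!
Over a complete discrete valuation ring an isogeny `f` of height one with all its kernel in `F(K)`
factors by Weierstrass preparation as `f(x) = u(x) ∏ (x - w)`, where `w` runs over the `p` points
of the kernel and `u` is a unit. The nonzero ones all have the same valuation `s`, so the leading
term of `f(x)` is read off from those of `x` and of the `w`: it is `β ξ ^ p` in degree `p j` if
`j = v(x) < s`, it is `α ξ + β ξ ^ p` in degree `p s` if `j = s`, and `α ξ` in degree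
`j + (p - 1) s` if `j > s`; here `v(D(f)) = (p - 1) s`. The graded quotients of the cokernel of a
composite follow by letting the leading terms run through the chain. The breaks are in order
because the kernel of the composite is cyclic: a point `y` killed by `φ_i ∘ φ_{i+1}` but not by
`p` has `p y` in the kernel of `φ_{i+1}`, which bounds the valuation of the kernel of `φ_{i+1}` from
below by the valuation of the kernel of `φ_i`.
-/

open FormalGroup FormalGroup.Hom

noncomputable section

namespace FormalIsogeny

/-! ### Evaluation of power series in one variable -/

section Evaluation

open PowerSeries Polynomial

variable {O : Type*} [CommRing O] [IsLocalRing O]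

theorem psEval_C (x c : O) : psEval x (PowerSeries.C c) = c := by
  let : WithIdeal O := ⟨maximalIdeal O⟩
  rw [psEval, tsum_eq_single 0 fun d hd => by simp [PowerSeries.coeff_C, hd]]
  simp

variable [IsAdicComplete (maximalIdeal O) O]

theorem isTopologicalSemiring_bot (R : Type*) [CommRing R] :
    @IsTopologicalSemiring R (⊥ : UniformSpace R).toTopologicalSpace _ :=
  letI : UniformSpace R := ⊥
  inferInstance

theorem isUniformAddGroup_bot (R : Type*) [CommRing R] : @IsUniformAddGroup R ⊥ _ :=
  letI : UniformSpace R := ⊥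
  inferInstance

/-- Evaluation of power series at a point of the maximal ideal, as a ring homomorphism. As in
`mvEvalAux`, the coefficients carry the discrete topology and the values the `𝔪`-adic one. -/
def psEvalHom {x : O} (hx : x ∈ maximalIdeal O) : O⟦X⟧ →+* O :=
  letI : WithIdeal O := ⟨maximalIdeal O⟩
  @MvPowerSeries.eval₂Hom Unit O _ ⊥ O _ _ (algebraMap O O) (fun _ => x)
    (isTopologicalSemiring_bot O) (isUniformAddGroup_bot O) _ adic_complete_t2.1 adic_complete_t2.2
    _ _ continuous_bot (adic_hasEval fun _ => hx)

theorem psEvalHom_apply {x : O} (hx : x ∈ maximalIdeal O) (f : O⟦X⟧) :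
    psEvalHom hx f = psEval x f := by
  rw [psEval_eq_mvEval hx, mvEval_eq_aux fun _ => hx]
  let : WithIdeal O := ⟨maximalIdeal O⟩
  exact congrFun (@MvPowerSeries.coe_eval₂Hom Unit O _ ⊥ O _ _ _ _ (isTopologicalSemiring_bot O)
    (isUniformAddGroup_bot O) _ adic_complete_t2.1 adic_complete_t2.2 _ _ continuous_bot
    (adic_hasEval fun _ => hx)) f

theorem psEval_mul {x : O} (hx : x ∈ maximalIdeal O) (f g : O⟦X⟧) :
    psEval x (f * g) = psEval x f * psEval x g := by
  simp only [← psEvalHom_apply hx, map_mul]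

theorem psEval_add {x : O} (hx : x ∈ maximalIdeal O) (f g : O⟦X⟧) :
    psEval x (f + g) = psEval x f + psEval x g := by
  simp only [← psEvalHom_apply hx, map_add]

theorem psEval_X {x : O} (hx : x ∈ maximalIdeal O) : psEval x (PowerSeries.X : O⟦X⟧) = x := by
  rw [psEval_eq_mvEval hx]
  exact mvEval_X (fun _ => hx) ()

theorem psEval_coe {x : O} (hx : x ∈ maximalIdeal O) (P : O[X]) :
    psEval x (P : O⟦X⟧) = P.eval x := by
  have : (psEvalHom hx).comp Polynomial.coeToPowerSeries.ringHom = Polynomial.evalRingHom x := by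
    refine Polynomial.ringHom_ext (fun a => ?_) ?_
    · simp [psEvalHom_apply, psEval_C]
    · simp [psEvalHom_apply, psEval_X hx]
  simpa [psEvalHom_apply] using RingHom.congr_fun this P

theorem psEval_X_pow_mul {x : O} (hx : x ∈ maximalIdeal O) (d : ℕ) (f : O⟦X⟧) :
    psEval x (PowerSeries.X ^ d * f) = x ^ d * psEval x f := by
  rw [psEval_mul hx, ← psEvalHom_apply hx, map_pow, psEvalHom_apply, psEval_X hx]

theorem psEval_eq_trunc_add {x : O} (hx : x ∈ maximalIdeal O) (f : O⟦X⟧) (d : ℕ) :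
    ∃ c, psEval x f = (trunc d f).eval x + x ^ d * c :=
  ⟨_, (congrArg (psEval x) (eq_X_pow_mul_shift_add_trunc d f)).trans (by
    rw [psEval_add hx, psEval_X_pow_mul hx, psEval_coe hx, add_comm])⟩

theorem dvd_psEval_sub_constantCoeff {x : O} (hx : x ∈ maximalIdeal O) (f : O⟦X⟧) :
    x ∣ psEval x f - PowerSeries.constantCoeff f := by
  obtain ⟨c, hc⟩ := psEval_eq_trunc_add hx f 1
  exact ⟨c, by simp [hc]⟩

theorem psEval_sub_eval_trunc_mem {x : O} (hx : x ∈ maximalIdeal O) (f : O⟦X⟧) (d : ℕ) :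
    psEval x f - (trunc d f).eval x ∈ maximalIdeal O ^ d := by
  obtain ⟨c, hc⟩ := psEval_eq_trunc_add hx f d
  rw [hc, add_sub_cancel_left]
  exact Ideal.mul_mem_right _ _ (Ideal.pow_mem_pow hx d)

theorem psEval_add_sub_sub_mem {x h : O} {N : ℕ} (hN : N ≠ 0) (hx : x ∈ maximalIdeal O)
    (hh : h ∈ maximalIdeal O ^ N) (f : O⟦X⟧) :
    psEval (x + h) f - psEval x f - h * psEval x (derivative O f) ∈ maximalIdeal O ^ (2 * N) := by
  obtain ⟨k, hk⟩ := Polynomial.binomExpansion (trunc (2 * N + 1) f) x h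
  have hxh := add_mem hx (Ideal.pow_le_self hN hh)
  have hle := Ideal.pow_le_pow_right (I := maximalIdeal O) (Nat.le_succ (2 * N))
  have h1 := hle (psEval_sub_eval_trunc_mem hxh f (2 * N + 1))
  have h2 := hle (psEval_sub_eval_trunc_mem hx f (2 * N + 1))
  have h3 := Ideal.mul_mem_left _ h (psEval_sub_eval_trunc_mem hx (derivative O f) (2 * N))
  have h4 := Ideal.mul_mem_left _ k (Ideal.pow_mem_pow hh 2)
  rw [trunc_derivative] at h3
  rw [← pow_mul, mul_comm N] at h4
  convert add_mem (sub_mem (sub_mem h1 h2) h3) h4 using 1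
  rw [hk]
  ring

theorem psEval_subst {x : O} (hx : x ∈ maximalIdeal O) {g : O⟦X⟧}
    (hg : PowerSeries.constantCoeff g = 0) (f : O⟦X⟧) :
    psEval x (subst g f) = psEval (psEval x g) f := by
  have hgx : psEval x g ∈ maximalIdeal O := by
    simpa using psEval_mem one_ne_zero (by simpa using hx) hg
  rw [psEval_eq_mvEval hx, psEval_eq_mvEval hgx, psEval_eq_mvEval hx, subst]
  exact mvEval_subst (fun _ => hg) (fun _ => hx) f

end Evaluation

/-! ### The filtration on the points of a formal group -/

section Points

variable {O : Type*} [CommRing O] [IsLocalRing O] [IsAdicComplete (maximalIdeal O) O]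
  {F G H : FormalGroup O}

theorem val_add_sub_mem (x y : F.Points) {N : ℕ} (hy : y.val ∈ maximalIdeal O ^ N) :
    (x + y).val - (x.val + y.val) ∈ maximalIdeal O ^ (N + 1) := by
  have h := F.mvEval_sub_mem x.mem y.mem (zero_mem _) (by simpa using hy)
  rw [F.mvEval_right_zero x.mem] at h
  rw [Points.val_add]
  convert h using 1
  ring

variable [F.IsComm] [G.IsComm] [H.IsComm]

theorem mem_fil {m : ℕ} {x : F.Points} : x ∈ F.fil m ↔ x.val ∈ maximalIdeal O ^ m := Iff.rfl

variable (F) in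
theorem fil_anti : Antitone F.fil := fun _ _ h _ hx => Ideal.pow_le_pow_right h hx

theorem sub_mem_fil_iff {N : ℕ} {x y : F.Points} :
    x - y ∈ F.fil N ↔ x.val - y.val ∈ maximalIdeal O ^ N := by
  obtain ⟨z, rfl⟩ : ∃ z, x = y + z := ⟨x - y, by abel⟩
  have hval {k : ℕ} (hz : z ∈ F.fil k) := val_add_sub_mem y z hz
  rw [add_sub_cancel_left]
  constructor
  · intro hz
    convert add_mem (Ideal.pow_le_pow_right (Nat.le_succ N) (hval hz)) hz using 1
    ring
  · intro h
    suffices H : ∀ k ≤ N, z ∈ F.fil k from H N le_rfl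
    intro k
    induction k with
    | zero => simp [mem_fil]
    | succ k ih =>
      intro hk
      rw [mem_fil]
      convert sub_mem (Ideal.pow_le_pow_right hk h) (hval (ih (by omega))) using 1
      ring

theorem eq_of_forall_sub_mem_fil {x y : F.Points} (h : ∀ k, x - y ∈ F.fil k) : x = y := by
  refine Points.ext (sub_eq_zero.1 (IsHausdorff.haus (I := maximalIdeal O) inferInstance _ ?_))
  intro k
  rw [SModEq.sub_mem, smul_eq_mul, Ideal.mul_top, sub_zero]
  exact sub_mem_fil_iff.1 (h k)

theorem exists_forall_sub_mem_fil {u : ℕ → F.Points} (hu : ∀ k, u (k + 1) - u k ∈ F.fil k) :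
    ∃ y, ∀ k, u k - y ∈ F.fil k := by
  have hcauchy {m n : ℕ} (hmn : m ≤ n) : u m - u n ∈ F.fil m := by
    induction n, hmn using Nat.le_induction with
    | base => simp
    | succ n hmn ih => simpa using sub_mem ih (fil_anti F hmn (hu n))
  have hval {m n : ℕ} (hmn : m ≤ n) :
      (u m).val ≡ (u n).val [SMOD (maximalIdeal O ^ m • ⊤ : Submodule O O)] := by
    rw [SModEq.sub_mem, smul_eq_mul, Ideal.mul_top]
    exact sub_mem_fil_iff.1 (hcauchy hmn)
  obtain ⟨y, hy⟩ := IsPrecomplete.prec (I := maximalIdeal O) inferInstance hval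
  simp only [SModEq.sub_mem, smul_eq_mul, Ideal.mul_top] at hy
  have hym : y ∈ maximalIdeal O := by
    rw [← sub_sub_cancel (u 1).val y]
    exact sub_mem (u 1).mem (by simpa only [pow_one] using hy 1)
  exact ⟨⟨y, hym⟩, fun k => sub_mem_fil_iff.2 (hy k)⟩

theorem onPoints_val (f : Hom F G) (x : F.Points) : (f.onPoints x).val = psEval x.val f.series :=
  rfl

theorem onPoints_comp (f : Hom G H) (g : Hom F G) :
    (f.comp g).onPoints = f.onPoints.comp g.onPoints := by
  ext x
  exact psEval_subst x.mem g.constantCoeff_series f.series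

theorem onPoints_id : (Hom.id F).onPoints = AddMonoidHom.id _ := by
  ext x
  exact psEval_X x.mem

theorem onPoints_mem_fil (f : Hom F G) {x : F.Points} {m : ℕ} (hx : x ∈ F.fil m) :
    f.onPoints x ∈ G.fil m := by
  rcases eq_or_ne m 0 with rfl | hm
  · simp [mem_fil]
  · exact psEval_mem hm hx f.constantCoeff_series

theorem exists_onPoints_eq_of_graded (f : Hom F G) {j₀ t : ℕ}
    (h : ∀ j, j₀ ≤ j → ∀ z ∈ G.fil (j + t), ∃ x ∈ F.fil j, z - f.onPoints x ∈ G.fil (j + t + 1))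
    {z : G.Points} (hz : z ∈ G.fil (j₀ + t)) : ∃ x ∈ F.fil j₀, f.onPoints x = z := by
  have step (k : ℕ) (x : F.Points) (hx : z - f.onPoints x ∈ G.fil (j₀ + k + t)) :
      ∃ x', x' - x ∈ F.fil (j₀ + k) ∧ z - f.onPoints x' ∈ G.fil (j₀ + (k + 1) + t) := by
    obtain ⟨y, hy, hy'⟩ := h (j₀ + k) (by omega) _ hx
    refine ⟨x + y, by simpa using hy, ?_⟩
    rwa [map_add, ← sub_sub, show j₀ + (k + 1) + t = j₀ + k + t + 1 by omega]
  choose! next hnext hnext' using step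
  let u : ℕ → F.Points := fun k => Nat.rec 0 next k
  have hu (k : ℕ) : z - f.onPoints (u k) ∈ G.fil (j₀ + k + t) := by
    induction k with
    | zero => simpa [u] using hz
    | succ k ih => exact hnext' k _ ih
  have hu' (k : ℕ) : u (k + 1) - u k ∈ F.fil (j₀ + k) := hnext k _ (hu k)
  obtain ⟨y, hy⟩ := exists_forall_sub_mem_fil fun k => fil_anti F (Nat.le_add_left k j₀) (hu' k)
  have hmem (k : ℕ) : u k ∈ F.fil j₀ := by
    induction k with
    | zero => exact zero_mem _
    | succ k ih => simpa using add_mem (fil_anti F (Nat.le_add_right j₀ k) (hu' k)) ih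
  refine ⟨y, by simpa using sub_mem (hmem j₀) (hy j₀), eq_of_forall_sub_mem_fil fun k => ?_⟩
  have hlim := onPoints_mem_fil f (hy k)
  rw [map_sub] at hlim
  simpa using neg_mem (add_mem (fil_anti G (by omega) (hu k)) hlim)

end Points

/-! ### Leading terms -/

section LeadingTerm

variable {O : Type*} [CommRing O] [IsDomain O] [IsDiscreteValuationRing O] {π : O}

theorem mem_maximalIdeal_pow_iff (hπ : Irreducible π) {N : ℕ} {x : O} :
    x ∈ maximalIdeal O ^ N ↔ π ^ N ∣ x := by
  rw [hπ.maximalIdeal_eq, Ideal.span_singleton_pow, Ideal.mem_span_singleton]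

theorem residue_eq_zero_iff_dvd (hπ : Irreducible π) {x : O} : residue O x = 0 ↔ π ∣ x := by
  rw [residue_eq_zero_iff, hπ.maximalIdeal_eq, Ideal.mem_span_singleton]

/-- `x ≡ π ^ m c` modulo `𝔪 ^ (m + 1)`. The leading coefficient `c ∈ k` is allowed to vanish, so
that leading terms in a fixed degree `m` form a group. -/
def HasLeadingTerm (π : O) (m : ℕ) (x : O) (c : ResidueField O) : Prop :=
  ∃ ξ, x = π ^ m * ξ ∧ residue O ξ = c

variable {m m' : ℕ} {x y : O} {c c' : ResidueField O}

theorem hasLeadingTerm_residue (π x : O) : HasLeadingTerm π 0 x (residue O x) :=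
  ⟨x, by simp, rfl⟩

theorem hasLeadingTerm_zero_iff (hπ : Irreducible π) :
    HasLeadingTerm π m x 0 ↔ x ∈ maximalIdeal O ^ (m + 1) := by
  rw [mem_maximalIdeal_pow_iff hπ, pow_succ]
  constructor
  · rintro ⟨ξ, rfl, hξ⟩
    exact mul_dvd_mul_left _ ((residue_eq_zero_iff_dvd hπ).1 hξ)
  · rintro ⟨ξ, rfl⟩
    exact ⟨π * ξ, mul_assoc .., (residue_eq_zero_iff_dvd hπ).2 (dvd_mul_right ..)⟩

theorem exists_hasLeadingTerm_iff (hπ : Irreducible π) :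
    (∃ c, HasLeadingTerm π m x c) ↔ x ∈ maximalIdeal O ^ m := by
  rw [mem_maximalIdeal_pow_iff hπ]
  exact ⟨fun ⟨_, ξ, hx, _⟩ => ⟨ξ, hx⟩, fun ⟨ξ, hx⟩ => ⟨_, ξ, hx, rfl⟩⟩

theorem exists_hasLeadingTerm_of_ne_zero (hπ : Irreducible π) (hx : x ≠ 0) :
    ∃ m c, c ≠ 0 ∧ HasLeadingTerm π m x c := by
  obtain ⟨m, u, hu⟩ := IsDiscreteValuationRing.eq_unit_mul_pow_irreducible hx hπ
  exact ⟨m, _, (u.isUnit.map (residue O)).ne_zero, u, by rw [hu, mul_comm], rfl⟩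

theorem exists_hasLeadingTerm_lt_or (hπ : Irreducible π) (s : ℕ) (x : O) :
    (∃ j < s, ∃ ξ ≠ 0, HasLeadingTerm π j x ξ) ∨ ∃ ξ, HasLeadingTerm π s x ξ := by
  rw [exists_hasLeadingTerm_iff hπ, or_iff_not_imp_right]
  intro hx
  obtain ⟨j, ξ, hξ, h⟩ :=
    exists_hasLeadingTerm_of_ne_zero hπ (x := x) fun h0 => hx (h0 ▸ zero_mem _)
  refine ⟨j, not_le.1 fun hsj => hx ?_, ξ, hξ, h⟩
  exact Ideal.pow_le_pow_right hsj ((exists_hasLeadingTerm_iff hπ).1 ⟨ξ, h⟩)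

theorem exists_hasLeadingTerm (π : O) (m : ℕ) (c : ResidueField O) :
    ∃ x, HasLeadingTerm π m x c := by
  obtain ⟨ξ, rfl⟩ := residue_surjective c
  exact ⟨_, ξ, rfl, rfl⟩

namespace HasLeadingTerm

theorem mem_pow (hπ : Irreducible π) (h : HasLeadingTerm π m x c) : x ∈ maximalIdeal O ^ m :=
  (exists_hasLeadingTerm_iff hπ).1 ⟨c, h⟩

theorem mul (h : HasLeadingTerm π m x c) (h' : HasLeadingTerm π m' y c') :
    HasLeadingTerm π (m + m') (x * y) (c * c') := by
  obtain ⟨ξ, rfl, rfl⟩ := h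
  obtain ⟨η, rfl, rfl⟩ := h'
  exact ⟨ξ * η, by ring, map_mul ..⟩

theorem prod {ι : Type*} {s : Finset ι} {x : ι → O} {c : ι → ResidueField O}
    (h : ∀ i ∈ s, HasLeadingTerm π m (x i) (c i)) :
    HasLeadingTerm π (s.card * m) (∏ i ∈ s, x i) (∏ i ∈ s, c i) := by
  classical
  induction s using Finset.induction_on with
  | empty => exact ⟨1, by simp, by simp⟩
  | insert a s ha ih =>
    rw [Finset.prod_insert ha, Finset.prod_insert ha, Finset.card_insert_of_notMem ha, add_one_mul,
      add_comm]
    exact (h a (Finset.mem_insert_self a s)).mul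
      (ih fun i hi => h i (Finset.mem_insert_of_mem hi))

theorem add (h : HasLeadingTerm π m x c) (h' : HasLeadingTerm π m y c') :
    HasLeadingTerm π m (x + y) (c + c') := by
  obtain ⟨ξ, rfl, rfl⟩ := h
  obtain ⟨η, rfl, rfl⟩ := h'
  exact ⟨ξ + η, by ring, map_add ..⟩

theorem neg (h : HasLeadingTerm π m x c) : HasLeadingTerm π m (-x) (-c) := by
  obtain ⟨ξ, rfl, rfl⟩ := h
  exact ⟨-ξ, by ring, map_neg ..⟩

theorem sub (h : HasLeadingTerm π m x c) (h' : HasLeadingTerm π m y c') :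
    HasLeadingTerm π m (x - y) (c - c') := by
  obtain ⟨ξ, rfl, rfl⟩ := h
  obtain ⟨η, rfl, rfl⟩ := h'
  exact ⟨ξ - η, by ring, map_sub ..⟩

theorem congr (hπ : Irreducible π) (h : HasLeadingTerm π m x c)
    (hxy : y - x ∈ maximalIdeal O ^ (m + 1)) : HasLeadingTerm π m y c := by
  simpa using h.add ((hasLeadingTerm_zero_iff hπ).2 hxy)

theorem unique (hπ : Irreducible π) (h : HasLeadingTerm π m x c) (h' : HasLeadingTerm π m x c') :
    c = c' := by
  obtain ⟨ξ, rfl, rfl⟩ := h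
  obtain ⟨η, hη, rfl⟩ := h'
  rw [mul_left_cancel₀ (pow_ne_zero m hπ.ne_zero) hη]

theorem eq_zero_of_lt (hπ : Irreducible π) (h : HasLeadingTerm π m x c)
    (h' : HasLeadingTerm π m' x c') (hlt : m < m') : c = 0 :=
  h.unique hπ ((hasLeadingTerm_zero_iff hπ).2 (Ideal.pow_le_pow_right hlt (h'.mem_pow hπ)))

theorem ne_zero (hπ : Irreducible π) (h : HasLeadingTerm π m x c) (hc : c ≠ 0) : x ≠ 0 := by
  rintro rfl
  exact hc (h.unique hπ ((hasLeadingTerm_zero_iff hπ).2 (zero_mem _)))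

theorem degree_ne_zero (h : HasLeadingTerm π m x c) (hc : c ≠ 0) (hx : x ∈ maximalIdeal O) :
    m ≠ 0 := by
  rintro rfl
  obtain ⟨ξ, rfl, rfl⟩ := h
  exact hc ((residue_eq_zero_iff _).2 (by simpa only [pow_zero, one_mul] using hx))

theorem le_degree (hπ : Irreducible π) (h : HasLeadingTerm π m x c) (hc : c ≠ 0)
    (hx : x ∈ maximalIdeal O ^ m') : m' ≤ m := by
  obtain ⟨c', h'⟩ := (exists_hasLeadingTerm_iff hπ).2 hx
  exact not_lt.1 fun hlt => hc (h.eq_zero_of_lt hπ h' hlt)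

theorem degree_eq (hπ : Irreducible π) (h : HasLeadingTerm π m x c) (hc : c ≠ 0)
    (h' : HasLeadingTerm π m' x c') (hc' : c' ≠ 0) : m = m' :=
  le_antisymm (h'.le_degree hπ hc' (h.mem_pow hπ)) (h.le_degree hπ hc (h'.mem_pow hπ))

theorem mul_mem_pow_iff (hπ : Irreducible π) (h : HasLeadingTerm π m x c) (hc : c ≠ 0) :
    x * y ∈ maximalIdeal O ^ (m + m') ↔ y ∈ maximalIdeal O ^ m' := by
  obtain ⟨ξ, rfl, rfl⟩ := h
  have hξ : IsUnit ξ := (residue_ne_zero_iff_isUnit ξ).1 hc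
  rw [mem_maximalIdeal_pow_iff hπ, mem_maximalIdeal_pow_iff hπ, pow_add, mul_assoc,
    mul_dvd_mul_iff_left (pow_ne_zero m hπ.ne_zero), hξ.dvd_mul_left]

theorem toNat_addVal (hπ : Irreducible π) (h : HasLeadingTerm π m x c) (hc : c ≠ 0) :
    (IsDiscreteValuationRing.addVal O x).toNat = m := by
  obtain ⟨ξ, rfl, rfl⟩ := h
  obtain ⟨u, rfl⟩ := residue_ne_zero_iff_isUnit ξ |>.1 hc
  rw [mul_comm, IsDiscreteValuationRing.addVal_def' u hπ m, ENat.toNat_natCast]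

end HasLeadingTerm

theorem eq_zero_of_forall_mem_pow (hπ : Irreducible π) {x : O}
    (h : ∀ N ≠ 0, x ∈ maximalIdeal O ^ N) : x = 0 := by
  by_contra hx
  obtain ⟨m, c, hc, hxc⟩ := exists_hasLeadingTerm_of_ne_zero hπ hx
  exact (hxc.le_degree hπ hc (h (m + 1) m.succ_ne_zero)).not_gt m.lt_succ_self

end LeadingTerm

/-! ### Graded pieces of the cokernel -/

section Graded

theorem nonempty_quotient_map_mk_equiv {M C : Type*} [AddCommGroup M] [AddCommGroup C]
    {A B : AddSubgroup M} (R : AddSubgroup M) {χ : A →+ C} (hχ : Function.Surjective χ)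
    (hker : ∀ x, χ x = 0 ↔ x.1 ∈ B) (hBA : B ≤ A) :
    Nonempty (A.map (QuotientAddGroup.mk' R) ⧸
        (B.map (QuotientAddGroup.mk' R)).addSubgroupOf (A.map (QuotientAddGroup.mk' R)) ≃+
      C ⧸ (R.addSubgroupOf A).map χ) := by
  let f₁ := (QuotientAddGroup.mk' ((B.map (QuotientAddGroup.mk' R)).addSubgroupOf
    (A.map (QuotientAddGroup.mk' R)))).comp ((QuotientAddGroup.mk' R).addSubgroupMap A)
  let f₂ := (QuotientAddGroup.mk' ((R.addSubgroupOf A).map χ)).comp χ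
  have h₁ : Function.Surjective f₁ := (QuotientAddGroup.mk'_surjective _).comp
    (AddMonoidHom.addSubgroupMap_surjective _ _)
  have h₂ : Function.Surjective f₂ := (QuotientAddGroup.mk'_surjective _).comp hχ
  have mem_ker₁ (x : A) : x ∈ f₁.ker ↔ ∃ b ∈ B, ∃ r ∈ R, b + r = x := by
    have hcomap := AddSubgroup.comap_map_eq (QuotientAddGroup.mk' R) B
    rw [QuotientAddGroup.ker_mk'] at hcomap
    rw [AddMonoidHom.mem_ker, ← AddSubgroup.mem_sup, ← hcomap]
    exact QuotientAddGroup.eq_zero_iff _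
  have mem_ker₂ (x : A) : x ∈ f₂.ker ↔ ∃ b ∈ B, ∃ r ∈ R, b + r = x := by
    refine AddMonoidHom.mem_ker.trans ((QuotientAddGroup.eq_zero_iff _).trans ?_)
    constructor
    · rintro ⟨r, hr, hrx⟩
      exact ⟨(x - r).1, (hker _).1 (by rw [map_sub, hrx, sub_self]), r, hr, by simp⟩
    · rintro ⟨b, hb, r, hr, hx⟩
      have hrA : r ∈ A := by
        rw [eq_sub_of_add_eq' hx]
        exact sub_mem x.2 (hBA hb)
      refine ⟨⟨r, hrA⟩, hr, ?_⟩
      obtain rfl : x = ⟨b, hBA hb⟩ + ⟨r, hrA⟩ := Subtype.ext hx.symm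
      rw [map_add, (hker ⟨b, hBA hb⟩).2 hb, _root_.zero_add]
  have hker₁₂ : f₁.ker = f₂.ker := AddSubgroup.ext fun x => (mem_ker₁ x).trans (mem_ker₂ x).symm
  exact ⟨(QuotientAddGroup.quotientKerEquivOfSurjective f₁ h₁).symm.trans
    ((QuotientAddGroup.quotientAddEquivOfEq hker₁₂).trans
      (QuotientAddGroup.quotientKerEquivOfSurjective f₂ h₂))⟩

variable {O : Type*} [CommRing O] [IsDomain O] [IsDiscreteValuationRing O] {π : O}

theorem exists_point_hasLeadingTerm (hπ : Irreducible π) (F : FormalGroup O) {m : ℕ} (hm : m ≠ 0)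
    (c : ResidueField O) : ∃ x : F.Points, HasLeadingTerm π m x.val c := by
  obtain ⟨x, hx⟩ := exists_hasLeadingTerm π m c
  exact ⟨⟨x, Ideal.pow_le_self hm (hx.mem_pow hπ)⟩, hx⟩

variable [IsAdicComplete (maximalIdeal O) O]

theorem hasLeadingTerm_val_add (hπ : Irreducible π) {F : FormalGroup O} {x y : F.Points} {m : ℕ}
    {c d : ResidueField O} (hx : HasLeadingTerm π m x.val c) (hy : HasLeadingTerm π m y.val d) :
    HasLeadingTerm π m (x + y).val (c + d) :=
  (hx.add hy).congr hπ (val_add_sub_mem x y (hy.mem_pow hπ))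

/-- The homomorphism `F^m(K) → k` taking a point to its leading coefficient in degree `m`; it
induces `F^m(K) / F^{m+1}(K) ≃ k` for `m ≥ 1`. -/
def gradedMap (hπ : Irreducible π) (F : FormalGroup O) [F.IsComm] (m : ℕ) :
    F.fil m →+ ResidueField O :=
  AddMonoidHom.mk' (fun x => ((exists_hasLeadingTerm_iff hπ).2 x.2).choose) fun x y =>
    HasLeadingTerm.unique hπ ((exists_hasLeadingTerm_iff hπ).2 (x + y).2).choose_spec
      (hasLeadingTerm_val_add hπ ((exists_hasLeadingTerm_iff hπ).2 x.2).choose_spec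
        ((exists_hasLeadingTerm_iff hπ).2 y.2).choose_spec)

theorem gradedMap_eq_iff (hπ : Irreducible π) {F : FormalGroup O} [F.IsComm] {m : ℕ} (x : F.fil m)
    {c : ResidueField O} : gradedMap hπ F m x = c ↔ HasLeadingTerm π m x.1.val c := by
  have h := ((exists_hasLeadingTerm_iff hπ).2 x.2).choose_spec
  constructor
  · rintro rfl
    exact h
  · exact h.unique hπ

variable {F G F' G' : FormalGroup O} [F.IsComm] [G.IsComm] [F'.IsComm] [G'.IsComm]

/-- The group of leading coefficients, in degree `m`, of the elements of `φ F(K)`. -/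
def leadGroup (hπ : Irreducible π) (φ : Hom F G) (m : ℕ) : AddSubgroup (ResidueField O) :=
  (φ.onPoints.range.addSubgroupOf (G.fil m)).map (gradedMap hπ G m)

theorem mem_leadGroup {hπ : Irreducible π} {φ : Hom F G} {m : ℕ} {c : ResidueField O} :
    c ∈ leadGroup hπ φ m ↔ ∃ x, HasLeadingTerm π m (φ.onPoints x).val c := by
  constructor
  · rintro ⟨z, ⟨x, hx⟩, hz⟩
    exact ⟨x, hx ▸ (gradedMap_eq_iff hπ z).1 hz⟩
  · rintro ⟨x, hx⟩
    exact ⟨⟨φ.onPoints x, hx.mem_pow hπ⟩, ⟨x, rfl⟩, (gradedMap_eq_iff hπ _).2 hx⟩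

theorem nonempty_gr_equiv (hπ : Irreducible π) (φ : Hom F G) {m : ℕ} (hm : m ≠ 0) :
    Nonempty (φ.gr m ≃+ ResidueField O ⧸ leadGroup hπ φ m) := by
  refine nonempty_quotient_map_mk_equiv _ (fun c => ?_) (fun x => ?_) (fil_anti G (Nat.le_succ m))
  · obtain ⟨x, hx⟩ := exists_point_hasLeadingTerm hπ G hm c
    exact ⟨⟨x, hx.mem_pow hπ⟩, (gradedMap_eq_iff hπ _).2 hx⟩
  · rw [gradedMap_eq_iff, hasLeadingTerm_zero_iff hπ, mem_fil]

theorem nonempty_gr_equiv_residueField (hπ : Irreducible π) (φ : Hom F G) {m : ℕ} (hm : m ≠ 0)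
    (h : leadGroup hπ φ m = ⊥) : Nonempty (φ.gr m ≃+ ResidueField O) := by
  obtain ⟨e⟩ := nonempty_gr_equiv hπ φ hm
  exact ⟨e.trans ((QuotientAddGroup.quotientAddEquivOfEq h).trans QuotientAddGroup.quotientBot)⟩

theorem subsingleton_gr_of_leadGroup_eq_top (hπ : Irreducible π) (φ : Hom F G) {m : ℕ} (hm : m ≠ 0)
    (h : leadGroup hπ φ m = ⊤) : Subsingleton (φ.gr m) := by
  obtain ⟨e⟩ := nonempty_gr_equiv hπ φ hm
  have := QuotientAddGroup.subsingleton_quotient_top (G := ResidueField O)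
  exact (e.trans (QuotientAddGroup.quotientAddEquivOfEq h)).toEquiv.subsingleton

theorem nonempty_gr_equiv_gr (hπ : Irreducible π) (φ : Hom F G) (ψ : Hom F' G') {m r : ℕ}
    (hm : m ≠ 0) (hr : r ≠ 0) {a : ResidueField O} (ha : a ≠ 0)
    (h : ∀ c, a * c ∈ leadGroup hπ φ m ↔ c ∈ leadGroup hπ ψ r) : Nonempty (φ.gr m ≃+ ψ.gr r) := by
  obtain ⟨e⟩ := nonempty_gr_equiv hπ φ hm
  obtain ⟨e'⟩ := nonempty_gr_equiv hπ ψ hr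
  let μ : ResidueField O ≃+ ResidueField O := DistribMulAction.toAddEquiv₀ _ a ha
  have hμ : (leadGroup hπ ψ r).map μ.toAddMonoidHom = leadGroup hπ φ m := by
    ext c
    constructor
    · rintro ⟨x, hx, rfl⟩
      exact (h x).2 hx
    · exact fun hc => ⟨a⁻¹ * c, (h _).1 (by rwa [mul_inv_cancel_left₀ ha]),
        mul_inv_cancel_left₀ ha c⟩
  exact ⟨e.trans ((QuotientAddGroup.congr _ _ μ hμ).symm.trans e'.symm)⟩

theorem cokerFil_eq_bot (φ : Hom F G) {m : ℕ} (h : G.fil m ≤ φ.onPoints.range) :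
    φ.cokerFil m = ⊥ := by
  rwa [cokerFil, AddSubgroup.map_eq_bot_iff, QuotientAddGroup.ker_mk']

theorem subsingleton_gr_of_cokerFil_eq_bot (φ : Hom F G) {m : ℕ} (h : φ.cokerFil m = ⊥) :
    Subsingleton (φ.gr m) := by
  have : Subsingleton (φ.cokerFil m) := by
    rw [h]
    infer_instance
  exact QuotientAddGroup.mk_surjective.subsingleton

end Graded

/-! ### The kernel and Weierstrass preparation -/

section Weierstrass

open scoped Polynomial PowerSeries

theorem constantCoeff_subst_of_constantCoeff_eq_zero {R : Type*} [CommRing R] {g : R⟦X⟧}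
    (hg : PowerSeries.constantCoeff g = 0) (f : R⟦X⟧) :
    PowerSeries.constantCoeff (f.subst g : R⟦X⟧) = PowerSeries.constantCoeff f := by
  have hs : PowerSeries.HasSubst g := .of_constantCoeff_zero' hg
  have hC : f - PowerSeries.C (PowerSeries.constantCoeff f) =
      PowerSeries.X * PowerSeries.mk fun i => PowerSeries.coeff (i + 1) f :=
    sub_eq_iff_eq_add.2 (PowerSeries.eq_X_mul_shift_add_const f)
  have hsub : f.subst g - PowerSeries.C (PowerSeries.constantCoeff f) =
      (g * PowerSeries.subst g (PowerSeries.mk fun i => PowerSeries.coeff (i + 1) f) : R⟦X⟧) := by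
    have := congrArg (PowerSeries.subst g) hC
    rwa [PowerSeries.subst_sub hs, PowerSeries.subst_mul hs, PowerSeries.subst_X hs,
      PowerSeries.subst_C] at this
  simpa [hg, sub_eq_zero] using congrArg PowerSeries.constantCoeff hsub

theorem order_subst {R : Type*} [CommRing R] [IsDomain R] {f g : R⟦X⟧} {d e : ℕ}
    (hf : f.order = d) (hg : g.order = e) (he : e ≠ 0) :
    PowerSeries.order (f.subst g) = (d * e : ℕ) := by
  have hg0 : PowerSeries.constantCoeff g = 0 :=
    PowerSeries.one_le_order_iff_constCoeff_eq_zero.1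
      (by rw [hg]; exact_mod_cast Nat.pos_of_ne_zero he)
  have hs : PowerSeries.HasSubst g := .of_constantCoeff_zero' hg0
  have hf0 : f ≠ 0 := by
    rintro rfl
    simp at hf
  have hunit : PowerSeries.order (f.divXPowOrder.subst g) = 0 := by
    rw [← not_ne_iff, PowerSeries.order_ne_zero_iff_constCoeff_eq_zero,
      constantCoeff_subst_of_constantCoeff_eq_zero hg0, PowerSeries.constantCoeff_divXPowOrder]
    exact PowerSeries.coeff_order hf0
  have hfac : (f.subst g : R⟦X⟧) = (g ^ d * f.divXPowOrder.subst g : R⟦X⟧) := by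
    conv_lhs => rw [← PowerSeries.X_pow_order_mul_divXPowOrder (f := f), hf, ENat.toNat_natCast,
      PowerSeries.subst_mul hs, PowerSeries.subst_pow hs, PowerSeries.subst_X hs]
  rw [hfac, PowerSeries.order_mul, hunit, PowerSeries.order_pow, hg]
  simp

theorem monic_eq_nodal {R ι : Type*} [CommRing R] [IsDomain R] [Fintype ι] {Q : R[X]}
    (hQ : Q.Monic) (hd : Q.natDegree = Fintype.card ι) {r : ι → R} (hr : Function.Injective r)
    (h : ∀ i, Q.eval (r i) = 0) : Q = Lagrange.nodal Finset.univ r := by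
  have hdeg : Q.degree = Finset.card (Finset.univ : Finset ι) := by
    rw [Polynomial.degree_eq_natDegree hQ.ne_zero, hd, Finset.card_univ]
  refine Polynomial.eq_of_degree_le_of_eval_index_eq _ hr.injOn hdeg.le ?_ ?_ fun i hi => ?_
  · rw [hdeg, Lagrange.degree_nodal]
  · rw [hQ.leadingCoeff, Lagrange.nodal_monic.leadingCoeff]
  · rw [h, Lagrange.eval_nodal_at_node hi]

variable {O : Type*} [CommRing O] [IsLocalRing O]

theorem residue_coeff_natDegree_mul {P : O[X]} (hP : P.IsDistinguishedAt (maximalIdeal O))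
    (u : O⟦X⟧) : residue O (PowerSeries.coeff P.natDegree (P * u)) =
      residue O (PowerSeries.constantCoeff u) := by
  have hmap : (P * u : O⟦X⟧).map (residue O) = PowerSeries.X ^ P.natDegree * u.map (residue O) := by
    have hPX : P.map (residue O) = Polynomial.X ^ P.natDegree := hP.map_eq_X_pow
    rw [map_mul, ← Polynomial.polynomial_map_coe, hPX, Polynomial.coe_pow, Polynomial.coe_X]
  rw [← PowerSeries.coeff_map, hmap, PowerSeries.coeff_X_pow_mul', if_pos le_rfl, Nat.sub_self,
    PowerSeries.coeff_map, PowerSeries.coeff_zero_eq_constantCoeff_apply]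

variable {F G H : FormalGroup O}

theorem order_map_residue_of_hasHeight {p : ℕ} (hp : p ≠ 0) {f : Hom F G} (h : f.HasHeight p 1) :
    (f.series.map (residue O)).order = p := by
  obtain ⟨ψ, hψ, e⟩ := h
  rw [pow_one] at e
  rw [PowerSeries.order_eq_nat, e]
  constructor
  · rw [PowerSeries.coeff_map, PowerSeries.coeff_subst_X_pow hp, if_pos dvd_rfl,
      Nat.div_self (Nat.pos_of_ne_zero hp)]
    exact (hψ.map (residue O)).ne_zero
  · intro i hi
    rcases Nat.eq_zero_or_pos i with rfl | hi0
    · rw [← e, PowerSeries.coeff_map, PowerSeries.coeff_zero_eq_constantCoeff_apply,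
        f.constantCoeff_series, map_zero]
    · rw [PowerSeries.coeff_map, PowerSeries.coeff_subst_X_pow hp,
        if_neg (Nat.not_dvd_of_pos_of_lt hi0 hi), map_zero]

theorem order_map_residue_comp {f : Hom G H} {g : Hom F G} {d e : ℕ}
    (hf : (f.series.map (residue O)).order = d) (hg : (g.series.map (residue O)).order = e)
    (he : e ≠ 0) : ((f.comp g).series.map (residue O)).order = (d * e : ℕ) := by
  have hs : PowerSeries.HasSubst g.series := .of_constantCoeff_zero' g.constantCoeff_series
  have hmap : PowerSeries.map (residue O) (PowerSeries.subst g.series f.series) =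
      PowerSeries.subst (g.series.map (residue O)) (f.series.map (residue O)) :=
    PowerSeries.map_subst hs _
  rw [comp, hmap]
  exact order_subst hf hg he

theorem mem_maximalIdeal_of_eval_eq_zero {P : O[X]} (hP : P.IsDistinguishedAt (maximalIdeal O))
    {y : O} (hy : P.eval y = 0) : y ∈ maximalIdeal O :=
  Ideal.IsPrime.mem_of_pow_mem inferInstance _
    (hP.toIsWeaklyEisensteinAt.pow_natDegree_le_of_root_of_monic_mem hy hP.monic _ le_rfl)

variable [IsAdicComplete (maximalIdeal O) O]

theorem exists_weierstrass_of_order {f : O⟦X⟧} {d : ℕ} (h : (f.map (residue O)).order = d) :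
    ∃ (P : O[X]) (u : O⟦X⟧), P.IsDistinguishedAt (maximalIdeal O) ∧ P.natDegree = d ∧
      IsUnit (PowerSeries.constantCoeff u) ∧ f = P * u := by
  have h0 : f.map (residue O) ≠ 0 := by
    intro h0
    simp [h0] at h
  obtain ⟨P, u, H⟩ := PowerSeries.exists_isWeierstrassFactorization h0
  exact ⟨P, u, H.isDistinguishedAt, by rw [H.natDegree_eq_toNat_order_map, h, ENat.toNat_natCast],
    PowerSeries.isUnit_iff_constantCoeff.1 H.isUnit, H.eq_mul⟩

variable [F.IsComm] [G.IsComm]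

theorem mem_ker_iff_eval {f : Hom F G} {P : O[X]} {u : O⟦X⟧}
    (hu : IsUnit (PowerSeries.constantCoeff u)) (h : f.series = P * u) {x : F.Points} :
    x ∈ f.onPoints.ker ↔ P.eval x.val = 0 := by
  have hux : IsUnit (psEval x.val u) := by
    rw [← psEvalHom_apply x.mem]
    exact (PowerSeries.isUnit_iff_constantCoeff.2 hu).map _
  rw [AddMonoidHom.mem_ker, Points.ext_iff, onPoints_val, h, psEval_mul x.mem, psEval_coe x.mem,
    Points.val_zero, hux.mul_left_eq_zero]

variable [IsDomain O] {f : Hom F G} {d : ℕ}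

open Classical in
theorem nonempty_ker_equiv_roots {P : O[X]} {u : O⟦X⟧} (hP : P.IsDistinguishedAt (maximalIdeal O))
    (hu : IsUnit (PowerSeries.constantCoeff u)) (h : f.series = P * u) :
    Nonempty (f.onPoints.ker ≃ P.roots.toFinset) := by
  have hroot {y : O} : y ∈ P.roots.toFinset ↔ P.eval y = 0 := by
    rw [Multiset.mem_toFinset, Polynomial.mem_roots hP.monic.ne_zero, Polynomial.IsRoot.def]
  exact ⟨{
    toFun := fun x => ⟨x.1.val, hroot.2 ((mem_ker_iff_eval hu h).1 x.2)⟩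
    invFun := fun y => ⟨⟨y, mem_maximalIdeal_of_eval_eq_zero hP (hroot.1 y.2)⟩,
      (mem_ker_iff_eval hu h).2 (hroot.1 y.2)⟩
    left_inv := fun _ => rfl
    right_inv := fun _ => rfl }⟩

theorem finite_ker_of_order (h : (f.series.map (residue O)).order = d) :
    Finite f.onPoints.ker ∧ Nat.card f.onPoints.ker ≤ d := by
  classical
  obtain ⟨P, u, hP, hd, hu, e⟩ := exists_weierstrass_of_order h
  obtain ⟨r⟩ := nonempty_ker_equiv_roots hP hu e
  refine ⟨.of_equiv _ r.symm, ?_⟩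
  rw [Nat.card_congr r, Nat.card_eq_fintype_card, Fintype.card_coe, ← hd]
  exact (Multiset.toFinset_card_le _).trans (Polynomial.card_roots' P)

theorem exists_series_eq_nodal_mul (h : (f.series.map (residue O)).order = d)
    [Fintype f.onPoints.ker] (hc : Fintype.card f.onPoints.ker = d) :
    ∃ u : O⟦X⟧, IsUnit (PowerSeries.constantCoeff u) ∧
      residue O (PowerSeries.coeff d f.series) = residue O (PowerSeries.constantCoeff u) ∧
      f.series =
        (Lagrange.nodal Finset.univ fun w : f.onPoints.ker => w.1.val : O[X]) * u := by
  obtain ⟨P, u, hP, hd, hu, e⟩ := exists_weierstrass_of_order h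
  have hPn : P = Lagrange.nodal Finset.univ fun w : f.onPoints.ker => w.1.val :=
    monic_eq_nodal hP.monic (hd.trans hc.symm)
      (fun _ _ hxy => Subtype.ext (Points.ext hxy)) fun w => (mem_ker_iff_eval hu e).1 w.2
  exact ⟨u, hu, by rw [e, ← hd, residue_coeff_natDegree_mul hP], hPn ▸ e⟩

end Weierstrass

/-! ### Leading terms of isogenies of height one -/

section LeadingTermLaw

open scoped Polynomial PowerSeries

theorem prod_sub_eq_of_injective {k A : Type*} [Field k] (p : ℕ) [hp : Fact p.Prime] [CharP k p]
    [AddCommGroup A] [Fintype A] [DecidableEq A] (hA : Fintype.card A = p) {Ω : A →+ k}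
    (hΩ : Function.Injective Ω) (ξ : k) :
    ∏ w, (ξ - Ω w) = (∏ w ∈ Finset.univ.erase 0, -Ω w) * ξ + ξ ^ p := by
  have hA' : Nat.card A = p := by rw [Nat.card_eq_fintype_card, hA]
  have : Nontrivial A := Fintype.one_lt_card_iff_nontrivial.1 (by rw [hA]; exact hp.out.one_lt)
  obtain ⟨w₀, hw₀⟩ := exists_ne (0 : A)
  obtain ⟨Q, hQ⟩ : ∃ Q : Polynomial k, Q = .C (-Ω w₀ ^ (p - 1)) * .X + .X ^ p := ⟨_, rfl⟩
  have hdeg : (.C (-Ω w₀ ^ (p - 1)) * .X : Polynomial k).degree < p :=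
    (Polynomial.degree_C_mul_X_le _).trans_lt (by exact_mod_cast hp.out.one_lt)
  have hroot (w : A) : Q.eval (Ω w) = 0 := by
    obtain ⟨n, rfl⟩ :=
      AddSubgroup.mem_zmultiples_iff.1 (mem_zmultiples_of_prime_card hA' hw₀ (g' := w))
    have hn : (n : k) ^ p = n := by rw [← frobenius_def, map_intCast]
    simp only [hQ, Polynomial.eval_add, Polynomial.eval_pow, Polynomial.eval_X, Polynomial.eval_mul,
      Polynomial.eval_C, map_zsmul, zsmul_eq_mul]
    rw [mul_pow, hn, mul_left_comm, neg_mul, ← pow_succ, Nat.sub_add_cancel hp.out.one_le,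
      mul_neg, neg_add_cancel]
  have hnodal : Q = Lagrange.nodal Finset.univ Ω := by
    refine monic_eq_nodal ?_ ?_ hΩ hroot
    · rw [hQ, add_comm]
      exact Polynomial.monic_X_pow_add hdeg
    · rw [hA, hQ, add_comm]
      rw [Polynomial.natDegree_add_eq_left_of_degree_lt (by rwa [Polynomial.degree_X_pow]),
        Polynomial.natDegree_X_pow]
  have hlin : -Ω w₀ ^ (p - 1) = ∏ w ∈ Finset.univ.erase 0, -Ω w := by
    have h := congrArg (Polynomial.coeff · 1) hnodal
    simp only [Lagrange.nodal_eq_mul_nodal_erase (Finset.mem_univ (0 : A)), map_zero, sub_zero,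
      Polynomial.coeff_X_mul, Polynomial.coeff_zero_eq_eval_zero, Lagrange.eval_nodal,
      zero_sub] at h
    rw [← h, hQ, Polynomial.coeff_add, Polynomial.coeff_C_mul, Polynomial.coeff_X_one, mul_one,
      Polynomial.coeff_X_pow, if_neg hp.out.ne_one.symm,
      _root_.add_zero]
  rw [← Lagrange.eval_nodal, ← hnodal, hQ, ← hlin]
  simp

variable {O : Type*} [CommRing O] [IsDomain O] [IsDiscreteValuationRing O] {π : O}

namespace HasLeadingTerm

variable {ι : Type*} {S : Finset ι} {r : ι → O} {c : ι → ResidueField O} {x : O}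
  {ξ : ResidueField O} {j s : ℕ}

theorem prod_sub_of_lt (hπ : Irreducible π) (hjs : j < s) (hx : HasLeadingTerm π j x ξ)
    (hr : ∀ i ∈ S, HasLeadingTerm π s (r i) (c i)) :
    HasLeadingTerm π (S.card * j) (∏ i ∈ S, (x - r i)) (ξ ^ S.card) := by
  rw [← Finset.prod_const]
  refine HasLeadingTerm.prod fun i hi => hx.congr hπ ?_
  rw [sub_sub_cancel_left]
  exact neg_mem (Ideal.pow_le_pow_right hjs ((hr i hi).mem_pow hπ))

theorem prod_sub_of_gt (hπ : Irreducible π) (hsj : s < j) (hx : HasLeadingTerm π j x ξ)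
    (hr : ∀ i ∈ S, HasLeadingTerm π s (r i) (c i)) :
    HasLeadingTerm π (S.card * s) (∏ i ∈ S, (x - r i)) (∏ i ∈ S, -c i) := by
  have hx0 : HasLeadingTerm π s x 0 :=
    (hasLeadingTerm_zero_iff hπ).2 (Ideal.pow_le_pow_right hsj (hx.mem_pow hπ))
  exact HasLeadingTerm.prod fun i hi => zero_sub (c i) ▸ hx0.sub (hr i hi)

end HasLeadingTerm

variable [IsAdicComplete (maximalIdeal O) O] {F G : FormalGroup O} [F.IsComm] [G.IsComm]

theorem exists_leadingCoeff_of_prime_card (hπ : Irreducible π) {p : ℕ} [hp : Fact p.Prime]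
    {A : AddSubgroup F.Points} (hA : Nat.card A = p) :
    ∃ s ≠ 0, ∃ Ω : A →+ ResidueField O, Function.Injective Ω ∧
      ∀ w, HasLeadingTerm π s w.1.val (Ω w) := by
  have : Finite A := Nat.finite_of_card_ne_zero (hA ▸ hp.out.ne_zero)
  have : Nontrivial A := Finite.one_lt_card_iff_nontrivial.1 (hA ▸ hp.out.one_lt)
  obtain ⟨w₀, hw₀⟩ := exists_ne (0 : A)
  obtain ⟨s, c, hc, hs⟩ := exists_hasLeadingTerm_of_ne_zero hπ (x := w₀.1.val)
    fun h => hw₀ (Subtype.ext (Points.ext h))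
  have hle : A ≤ F.fil s := by
    intro w hw
    obtain ⟨n, hn⟩ := AddSubgroup.mem_zmultiples_iff.1
      (mem_zmultiples_of_prime_card hA hw₀ (g' := ⟨w, hw⟩))
    rw [← show n • w₀.1 = w from congrArg Subtype.val hn]
    exact zsmul_mem (show w₀.1 ∈ F.fil s from hs.mem_pow hπ) n
  let Ω : A →+ ResidueField O := (gradedMap hπ F s).comp (AddSubgroup.inclusion hle)
  have hΩ (w : A) : HasLeadingTerm π s w.1.val (Ω w) := 
    (gradedMap_eq_iff hπ (AddSubgroup.inclusion hle w)).1 rfl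
  refine ⟨s, hs.degree_ne_zero hc w₀.1.mem, Ω, (AddMonoidHom.ker_eq_bot_iff Ω).1 ?_, hΩ⟩
  have : Fact (Nat.card A).Prime := hA ▸ hp
  refine (AddSubgroup.eq_bot_or_eq_top_of_prime_card Ω.ker).resolve_right fun htop => hc ?_
  rw [hs.unique hπ (hΩ w₀)]
  exact htop.ge (AddSubgroup.mem_top w₀)

section Nodal

variable {f : Hom F G} [Fintype f.onPoints.ker] {u : O⟦X⟧}

theorem onPoints_val_eq_prod_mul
    (h : f.series = (Lagrange.nodal Finset.univ fun w : f.onPoints.ker => w.1.val : O[X]) * u)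
    (x : F.Points) :
    (f.onPoints x).val = (∏ w : f.onPoints.ker, (x.val - w.1.val)) * psEval x.val u := by
  rw [onPoints_val, h, psEval_mul x.mem, psEval_coe x.mem, Lagrange.eval_nodal]

theorem linCoeff_eq_prod_mul [DecidableEq f.onPoints.ker]
    (h : f.series = (Lagrange.nodal Finset.univ fun w : f.onPoints.ker => w.1.val : O[X]) * u) :
    f.linCoeff = (∏ w ∈ Finset.univ.erase (0 : f.onPoints.ker), -w.1.val) *
      PowerSeries.constantCoeff u := by
  rw [linCoeff, h, Lagrange.nodal_eq_mul_nodal_erase (Finset.mem_univ (0 : f.onPoints.ker)),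
    AddSubgroup.coe_zero, Points.val_zero, map_zero, sub_zero, Polynomial.coe_mul,
    Polynomial.coe_X, mul_assoc, PowerSeries.coeff_succ_X_mul 0,
    PowerSeries.coeff_zero_eq_constantCoeff_apply, map_mul]
  congr 1
  rw [Polynomial.constantCoeff_coe, Polynomial.coeff_zero_eq_eval_zero, Lagrange.eval_nodal]
  simp only [zero_sub]

end Nodal

theorem hasLeadingTerm_psEval (hπ : Irreducible π) {x : O} (hx : x ∈ maximalIdeal O) (u : O⟦X⟧) :
    HasLeadingTerm π 0 (psEval x u) (residue O (PowerSeries.constantCoeff u)) := by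
  refine (hasLeadingTerm_residue π _).congr hπ ?_
  rw [_root_.zero_add, pow_one]
  exact Ideal.mem_of_dvd _ (dvd_psEval_sub_constantCoeff hx u) hx

/-- The behaviour on leading terms of an isogeny `f` of height one all of whose kernel lies in
`F(K)`. Here `s` is the common valuation of the nonzero points of the kernel, `β` the residue of
the coefficient of `T ^ p` in `f`, and `α` the leading coefficient of `D(f)`. -/
structure LeadingTermLaw (π : O) (p : ℕ) (f : Hom F G) (s : ℕ) (α β : ResidueField O) : Prop where
  ne_zero : s ≠ 0
  lin_ne_zero : α ≠ 0
  top_ne_zero : β ≠ 0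
  exists_root : ∃ ω ≠ 0, α * ω + β * ω ^ p = 0
  linCoeff : HasLeadingTerm π ((p - 1) * s) f.linCoeff α
  residue_coeff : residue O (PowerSeries.coeff p f.series) = β
  low {x : F.Points} {j : ℕ} {ξ : ResidueField O} (hjs : j < s) (hx : HasLeadingTerm π j x.val ξ) :
    HasLeadingTerm π (p * j) (f.onPoints x).val (β * ξ ^ p)
  mid {x : F.Points} {ξ : ResidueField O} (hx : HasLeadingTerm π s x.val ξ) :
    HasLeadingTerm π (p * s) (f.onPoints x).val (α * ξ + β * ξ ^ p)
  high {x : F.Points} {j : ℕ} {ξ : ResidueField O} (hsj : s < j) (hx : HasLeadingTerm π j x.val ξ) :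
    HasLeadingTerm π (j + (p - 1) * s) (f.onPoints x).val (α * ξ)
  exists_of_mem_ker {w : F.Points} (hw : w ∈ f.onPoints.ker) (hw0 : w ≠ 0) :
    ∃ ω ≠ 0, HasLeadingTerm π s w.val ω
  exists_mem_ker {ω : ResidueField O} (hω : α * ω + β * ω ^ p = 0) :
    ∃ w ∈ f.onPoints.ker, HasLeadingTerm π s w.val ω

theorem leadingTermLaw_of_series_eq (hπ : Irreducible π) {p : ℕ} [hp : Fact p.Prime]
    [CharP (ResidueField O) p] {f : Hom F G} [Fintype f.onPoints.ker] [DecidableEq f.onPoints.ker]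
    (hcard : Fintype.card f.onPoints.ker = p) {u : O⟦X⟧}
    (h : f.series = (Lagrange.nodal Finset.univ fun w : f.onPoints.ker => w.1.val : O[X]) * u)
    {s : ℕ} (hs : s ≠ 0) {Ω : f.onPoints.ker →+ ResidueField O} (hΩi : Function.Injective Ω)
    (hΩ : ∀ w, HasLeadingTerm π s w.1.val (Ω w)) {β : ResidueField O} (hβ0 : β ≠ 0)
    (hβ : residue O (PowerSeries.constantCoeff u) = β)
    (hcoeff : residue O (PowerSeries.coeff p f.series) = β) :
    LeadingTermLaw π p f s ((∏ w ∈ Finset.univ.erase 0, -Ω w) * β) β := by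
  have hunit (x : F.Points) : HasLeadingTerm π 0 (psEval x.val u) β :=
    hβ ▸ hasLeadingTerm_psEval hπ x.mem u
  have hcard' : (Finset.univ.erase (0 : f.onPoints.ker)).card = p - 1 := by
    rw [Finset.card_erase_of_mem (Finset.mem_univ _), Finset.card_univ, hcard]
  have hprod (ξ : ResidueField O) : (∏ w, (ξ - Ω w)) * β =
      (∏ w ∈ Finset.univ.erase 0, -Ω w) * β * ξ + β * ξ ^ p := by
    rw [prod_sub_eq_of_injective p hcard hΩi]
    ring
  have : Nontrivial f.onPoints.ker := Fintype.one_lt_card_iff_nontrivial.1 (hcard ▸ hp.out.one_lt)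
  obtain ⟨w₀, hw₀⟩ := exists_ne (0 : f.onPoints.ker)
  exact
  { ne_zero := hs
    lin_ne_zero := mul_ne_zero (Finset.prod_ne_zero_iff.2 fun w hw => neg_ne_zero.2 <|
      (map_ne_zero_iff Ω hΩi).2 (Finset.ne_of_mem_erase hw)) hβ0
    top_ne_zero := hβ0
    exists_root := ⟨Ω w₀, (map_ne_zero_iff Ω hΩi).2 hw₀, by
      rw [← hprod, Finset.prod_eq_zero (Finset.mem_univ w₀) (sub_self _), zero_mul]⟩
    linCoeff := by
      rw [linCoeff_eq_prod_mul h, ← hcard']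
      exact (HasLeadingTerm.prod fun w _ => (hΩ w).neg).mul (hβ ▸ hasLeadingTerm_residue π _)
    residue_coeff := hcoeff
    low := fun {x j ξ} hjs hx => by
      rw [onPoints_val_eq_prod_mul h, mul_comm β, ← hcard, ← Finset.card_univ]
      exact (hx.prod_sub_of_lt hπ hjs fun w _ => hΩ w).mul (hunit x)
    mid := fun {x ξ} hx => by
      rw [onPoints_val_eq_prod_mul h, ← hprod, ← hcard, ← Finset.card_univ]
      exact (HasLeadingTerm.prod fun w _ => hx.sub (hΩ w)).mul (hunit x)
    high := fun {x j ξ} hsj hx => by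
      rw [onPoints_val_eq_prod_mul h, ← Finset.mul_prod_erase _ _ (Finset.mem_univ 0),
        AddSubgroup.coe_zero, Points.val_zero, sub_zero, ← hcard', mul_comm _ ξ, ← mul_assoc]
      exact (hx.mul (hx.prod_sub_of_gt hπ hsj fun w _ => hΩ w)).mul (hunit x)
    exists_of_mem_ker := fun {w} hw hw0 => ⟨Ω ⟨w, hw⟩, (map_ne_zero_iff Ω hΩi).2 fun h => hw0 <|
      congrArg Subtype.val h, hΩ ⟨w, hw⟩⟩
    exists_mem_ker := fun {ω} hω => by
      rw [← hprod, mul_eq_zero, or_iff_left hβ0, Finset.prod_eq_zero_iff] at hω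
      obtain ⟨w, -, hw⟩ := hω
      exact ⟨w, w.2, sub_eq_zero.1 hw ▸ hΩ w⟩ }

theorem exists_leadingTermLaw (hπ : Irreducible π) {p : ℕ} [hp : Fact p.Prime]
    [CharP (ResidueField O) p] {f : Hom F G} (hord : (f.series.map (residue O)).order = p)
    (hcard : Nat.card f.onPoints.ker = p) : ∃ s α β, LeadingTermLaw π p f s α β := by
  classical
  obtain ⟨s, hs, Ω, hΩi, hΩ⟩ := exists_leadingCoeff_of_prime_card hπ hcard
  have : Finite f.onPoints.ker := Nat.finite_of_card_ne_zero (hcard ▸ hp.out.ne_zero)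
  have : Fintype f.onPoints.ker := Fintype.ofFinite _
  rw [Nat.card_eq_fintype_card] at hcard
  obtain ⟨u, hu, hcoeff, h⟩ := exists_series_eq_nodal_mul hord hcard
  exact ⟨s, _, _, leadingTermLaw_of_series_eq hπ hcard h hs hΩi hΩ (hu.map (residue O)).ne_zero rfl
    hcoeff⟩

end LeadingTermLaw

section LeadGroup

variable {O : Type*} [CommRing O] [IsDomain O] [IsDiscreteValuationRing O]
  [IsAdicComplete (maximalIdeal O) O] {π : O} {F G H : FormalGroup O} [F.IsComm] [G.IsComm]
  [H.IsComm] {p : ℕ}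

theorem mul_eq_add_pred_mul (hp : 1 ≤ p) (s : ℕ) : p * s = s + (p - 1) * s := by
  rw [Nat.sub_one_mul, Nat.add_sub_cancel' (Nat.le_mul_of_pos_left s hp)]

theorem prime_nsmul_mem_fil_succ (hπ : Irreducible π) [CharP (ResidueField O) p] {j : ℕ}
    {x : F.Points} (hx : x ∈ F.fil j) : p • x ∈ F.fil (j + 1) := by
  rw [mem_fil, ← hasLeadingTerm_zero_iff hπ]
  refine (gradedMap_eq_iff hπ (p • (⟨x, hx⟩ : F.fil j))).1 ?_
  rw [map_nsmul, nsmul_eq_mul, CharP.cast_eq_zero, zero_mul]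

namespace LeadingTermLaw

variable {f : Hom G H} {s : ℕ} {α β : ResidueField O}

theorem exists_hasLeadingTerm_of_mem_fil [hp : Fact p.Prime] (hπ : Irreducible π)
    (h : LeadingTermLaw π p f s α β) {y : G.Points} (hy : f.onPoints y ∈ H.fil (p * s)) :
    ∃ ξ, HasLeadingTerm π s y.val ξ := by
  refine (exists_hasLeadingTerm_lt_or hπ s y.val).resolve_left ?_
  rintro ⟨j, hjs, ξ, hξ, hyξ⟩
  have hle := (h.low hjs hyξ).le_degree hπ (mul_ne_zero h.top_ne_zero (pow_ne_zero p hξ)) hy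
  exact hjs.not_ge (Nat.le_of_mul_le_mul_left hle hp.out.pos)

theorem mem_leadGroup_low (hπ : Irreducible π) (h : LeadingTermLaw π p f s α β) (ψ : Hom F G)
    {m : ℕ} (hm : m < p * s) {c : ResidueField O} (hc : c ≠ 0) :
    c ∈ leadGroup hπ (f.comp ψ) m ↔
      ∃ r, m = p * r ∧ r ≠ 0 ∧ ∃ ξ ∈ leadGroup hπ ψ r, c = β * ξ ^ p := by
  simp only [mem_leadGroup, onPoints_comp, AddMonoidHom.comp_apply]
  constructor
  · rintro ⟨x, hx⟩
    rcases exists_hasLeadingTerm_lt_or hπ s (ψ.onPoints x).val with ⟨r, hrs, ξ, hξ, hy⟩ | ⟨ξ, hy⟩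
    · have hlow := h.low hrs hy
      obtain rfl := hx.degree_eq hπ hc hlow (mul_ne_zero h.top_ne_zero (pow_ne_zero p hξ))
      exact ⟨r, rfl, hy.degree_ne_zero hξ (ψ.onPoints x).mem, ξ, ⟨x, hy⟩, hx.unique hπ hlow⟩
    · exact absurd (hx.eq_zero_of_lt hπ (h.mid hy) hm) hc
  · rintro ⟨r, rfl, -, ξ, ⟨x, hx⟩, rfl⟩
    exact ⟨x, h.low (Nat.lt_of_mul_lt_mul_left hm) hx⟩

theorem mem_leadGroup_mid [Fact p.Prime] (hπ : Irreducible π) (h : LeadingTermLaw π p f s α β)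
    (ψ : Hom F G) {c : ResidueField O} : c ∈ leadGroup hπ (f.comp ψ) (p * s) ↔
      ∃ ξ ∈ leadGroup hπ ψ s, c = α * ξ + β * ξ ^ p := by
  simp only [mem_leadGroup, onPoints_comp, AddMonoidHom.comp_apply]
  constructor
  · rintro ⟨x, hx⟩
    obtain ⟨ξ, hy⟩ := h.exists_hasLeadingTerm_of_mem_fil hπ (hx.mem_pow hπ)
    exact ⟨ξ, ⟨x, hy⟩, hx.unique hπ (h.mid hy)⟩
  · rintro ⟨ξ, ⟨x, hx⟩, rfl⟩
    exact ⟨x, h.mid hx⟩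

theorem exists_mem_ker_hasLeadingTerm_sub [hp : Fact p.Prime] (hπ : Irreducible π)
    (h : LeadingTermLaw π p f s α β) {r : ℕ} (hr : s < r) {c : ResidueField O} (hc : c ≠ 0)
    {y : G.Points} (hy : HasLeadingTerm π (r + (p - 1) * s) (f.onPoints y).val (α * c)) :
    ∃ w ∈ f.onPoints.ker, HasLeadingTerm π r (y - w).val c := by
  have hlt : p * s < r + (p - 1) * s := by
    rw [mul_eq_add_pred_mul hp.out.one_le]
    exact Nat.add_lt_add_right hr _
  obtain ⟨ξ, hyξ⟩ := h.exists_hasLeadingTerm_of_mem_fil hπ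
    (fil_anti H hlt.le (hy.mem_pow hπ))
  obtain ⟨w, hw, hwξ⟩ := h.exists_mem_ker ((h.mid hyξ).eq_zero_of_lt hπ hy hlt)
  have hsub : y - w ∈ G.fil (s + 1) := by
    rw [sub_mem_fil_iff, ← hasLeadingTerm_zero_iff hπ, ← sub_self ξ]
    exact hyξ.sub hwξ
  rw [← sub_zero (f.onPoints y), ← AddMonoidHom.mem_ker.1 hw, ← map_sub] at hy
  have hαc : α * c ≠ 0 := mul_ne_zero h.lin_ne_zero hc
  obtain ⟨j, η, hη, hj⟩ := exists_hasLeadingTerm_of_ne_zero hπ (x := (y - w).val) fun h0 =>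
    hy.ne_zero hπ hαc (by rw [show y - w = 0 from Points.ext h0, map_zero, Points.val_zero])
  have hhigh := h.high (hj.le_degree hπ hη hsub) hj
  obtain rfl : r = j :=
    Nat.add_right_cancel (hy.degree_eq hπ hαc hhigh (mul_ne_zero h.lin_ne_zero hη))
  exact ⟨w, hw, mul_left_cancel₀ h.lin_ne_zero (hy.unique hπ hhigh) ▸ hj⟩

theorem mem_leadGroup_high [Fact p.Prime] (hπ : Irreducible π) (h : LeadingTermLaw π p f s α β)
    (ψ : Hom F G) (hker : f.onPoints.ker ≤ ψ.onPoints.range) {r : ℕ} (hr : s < r)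
    (c : ResidueField O) :
    α * c ∈ leadGroup hπ (f.comp ψ) (r + (p - 1) * s) ↔ c ∈ leadGroup hπ ψ r := by
  simp only [mem_leadGroup, onPoints_comp, AddMonoidHom.comp_apply]
  constructor
  · rintro ⟨x, hx⟩
    rcases eq_or_ne c 0 with rfl | hc
    · exact mem_leadGroup.1 (zero_mem (leadGroup hπ ψ r))
    obtain ⟨w, hw, hsub⟩ := h.exists_mem_ker_hasLeadingTerm_sub hπ hr hc hx
    obtain ⟨z, rfl⟩ := hker hw
    exact ⟨x - z, by rwa [map_sub]⟩
  · rintro ⟨x, hx⟩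
    exact ⟨x, h.high hr hx⟩

theorem exists_onPoints_eq (hπ : Irreducible π) (h : LeadingTermLaw π p f s α β) {r : ℕ}
    (hr : s < r) {z : H.Points} (hz : z ∈ H.fil (r + (p - 1) * s)) :
    ∃ x ∈ G.fil r, f.onPoints x = z := by
  refine exists_onPoints_eq_of_graded f (fun j hj z hz => ?_) hz
  obtain ⟨c, hc⟩ := (exists_hasLeadingTerm_iff hπ).2 hz
  obtain ⟨x, hx⟩ := exists_point_hasLeadingTerm hπ G (by omega : j ≠ 0) (α⁻¹ * c)
  refine ⟨x, hx.mem_pow hπ, ?_⟩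
  have hfx := h.high (by omega) hx
  rw [mul_inv_cancel_left₀ h.lin_ne_zero] at hfx
  rw [sub_mem_fil_iff, ← hasLeadingTerm_zero_iff hπ, ← sub_self c]
  exact hc.sub hfx

theorem onPoints_notMem_fil_of_prime_nsmul_mem_ker [Fact p.Prime] (hπ : Irreducible π)
    [CharP (ResidueField O) p] (h : LeadingTermLaw π p f s α β) {y : G.Points} (hpy : p • y ≠ 0)
    (hker : p • y ∈ f.onPoints.ker) : f.onPoints y ∉ H.fil (p * s) := by
  intro hy
  obtain ⟨ξ, hyξ⟩ := h.exists_hasLeadingTerm_of_mem_fil hπ hy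
  obtain ⟨ω, hω, hpω⟩ := h.exists_of_mem_ker hker hpy
  have hmem : p • y ∈ G.fil (s + 1) := prime_nsmul_mem_fil_succ hπ (hyξ.mem_pow hπ)
  exact (hpω.le_degree hπ hω hmem).not_gt (Nat.lt_succ_self s)

end LeadingTermLaw

end LeadGroup

/-! ### Isogenies with rational kernel -/

section Separable

open scoped Polynomial PowerSeries
open PowerSeries (derivative)

variable {O : Type*} [CommRing O] [IsDomain O] [IsDiscreteValuationRing O]
  [IsAdicComplete (maximalIdeal O) O] {π : O} {F G : FormalGroup O} [F.IsComm] [G.IsComm]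

theorem psEval_zero_left (f : O⟦X⟧) : psEval 0 f = PowerSeries.constantCoeff f :=
  sub_eq_zero.1 (zero_dvd_iff.1 (dvd_psEval_sub_constantCoeff (zero_mem _) f))

-- Expand `f (w + x) = f w + f x` in `x`: the left-hand side does not depend on `w`.
theorem onPoints_mem_fil_two_mul_iff (hπ : Irreducible π) (f : Hom F G) (w : F.Points)
    {x : F.Points} {N : ℕ} {c : ResidueField O} (hx : HasLeadingTerm π N x.val c) (hc : c ≠ 0) :
    f.onPoints x ∈ G.fil (2 * N) ↔ psEval w.val (derivative O f.series) ∈ maximalIdeal O ^ N := by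
  have hN : N ≠ 0 := hx.degree_ne_zero hc x.mem
  have hwx : HasLeadingTerm π N ((w + x).val - w.val) c := hx.congr hπ (by
    rw [sub_sub]
    exact val_add_sub_mem w x (hx.mem_pow hπ))
  have htaylor := psEval_add_sub_sub_mem hN w.mem (hwx.mem_pow hπ) f.series
  rw [add_sub_cancel, ← onPoints_val, ← onPoints_val] at htaylor
  rw [← add_sub_cancel_left (f.onPoints w) (f.onPoints x), ← map_add, sub_mem_fil_iff,
    ← hwx.mul_mem_pow_iff (m' := N) hπ hc, ← two_mul]
  exact ⟨fun h => (Submodule.sub_mem_iff_right _ h).1 htaylor,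
    fun h => (Submodule.sub_mem_iff_left _ h).1 htaylor⟩

theorem psEval_derivative_eq_zero_iff (hπ : Irreducible π) (f : Hom F G) (w : F.Points) :
    psEval w.val (derivative O f.series) = 0 ↔ f.linCoeff = 0 := by
  have hlin : psEval (0 : F.Points).val (derivative O f.series) = f.linCoeff := by
    rw [Points.val_zero, psEval_zero_left, ← PowerSeries.coeff_zero_eq_constantCoeff_apply,
      PowerSeries.coeff_derivative]
    simp [linCoeff]
  have hiff {N : ℕ} (hN : N ≠ 0) : psEval w.val (derivative O f.series) ∈ maximalIdeal O ^ N ↔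
      f.linCoeff ∈ maximalIdeal O ^ N := by
    obtain ⟨x, hx⟩ := exists_point_hasLeadingTerm hπ F hN 1
    rw [← onPoints_mem_fil_two_mul_iff hπ f w hx one_ne_zero, ← hlin,
      ← onPoints_mem_fil_two_mul_iff hπ f 0 hx one_ne_zero]
  exact ⟨fun h => eq_zero_of_forall_mem_pow hπ fun N hN => (hiff hN).1 (h ▸ zero_mem _),
    fun h => eq_zero_of_forall_mem_pow hπ fun N hN => (hiff hN).2 (h ▸ zero_mem _)⟩

theorem eq_zero_of_forall_psEval_eq_zero (hπ : Irreducible π) {f : O⟦X⟧}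
    (h : ∀ x ∈ maximalIdeal O, psEval x f = 0) : f = 0 := by
  by_contra hf
  have hg : PowerSeries.constantCoeff f.divXPowOrder ≠ 0 := by
    rw [PowerSeries.constantCoeff_divXPowOrder]
    exact PowerSeries.coeff_order hf
  refine hg (eq_zero_of_forall_mem_pow hπ fun N hN => ?_)
  have hx : π ^ N ∈ maximalIdeal O :=
    Ideal.pow_le_self hN ((mem_maximalIdeal_pow_iff hπ).2 dvd_rfl)
  have hgx := h _ hx
  rw [← PowerSeries.X_pow_order_mul_divXPowOrder (f := f), psEval_X_pow_mul hx] at hgx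
  have hdvd := dvd_psEval_sub_constantCoeff hx f.divXPowOrder
  rw [(mul_eq_zero.1 hgx).resolve_left (pow_ne_zero _ (pow_ne_zero N hπ.ne_zero)), zero_sub,
    dvd_neg] at hdvd
  exact (mem_maximalIdeal_pow_iff hπ).2 hdvd

theorem linCoeff_ne_zero [CharZero O] (hπ : Irreducible π) {f : Hom F G} (hf : f.series ≠ 0) :
    f.linCoeff ≠ 0 := by
  intro hlin
  refine hf (PowerSeries.derivative.ext ?_ (by simpa using f.constantCoeff_series))
  rw [map_zero]
  exact eq_zero_of_forall_psEval_eq_zero hπ fun x hx =>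
    (psEval_derivative_eq_zero_iff hπ f ⟨x, hx⟩).2 hlin

theorem nodup_roots_of_linCoeff_ne_zero (hπ : Irreducible π) {f : Hom F G} (hf : f.linCoeff ≠ 0)
    {P : O[X]} {u : O⟦X⟧} (hP : P.IsDistinguishedAt (maximalIdeal O)) (h : f.series = P * u) :
    P.roots.Nodup := by
  classical
  rw [Multiset.nodup_iff_count_le_one]
  intro y
  rw [Polynomial.count_roots]
  by_contra! hlt
  obtain ⟨hy, hy'⟩ := (Polynomial.one_lt_rootMultiplicity_iff_isRoot hP.monic.ne_zero).1 hlt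
  have hym : y ∈ maximalIdeal O := mem_maximalIdeal_of_eval_eq_zero hP hy
  refine hf ((psEval_derivative_eq_zero_iff hπ f ⟨y, hym⟩).1 ?_)
  rw [h, Derivation.leibniz, PowerSeries.derivative_coe, smul_eq_mul, smul_eq_mul, psEval_add hym,
    psEval_mul hym, psEval_mul hym, psEval_coe hym, psEval_coe hym, hy.eq_zero, hy'.eq_zero,
    zero_mul, mul_zero, _root_.add_zero]

end Separable

section Rational

open scoped Polynomial PowerSeries

theorem X_pow_dvd_trunc_mul_sub {R : Type*} [CommRing R] (P : R[X]) (u : R⟦X⟧) (m : ℕ) :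
    Polynomial.X ^ m ∣ PowerSeries.trunc m ((P : R⟦X⟧) * u) - P * PowerSeries.trunc m u := by
  rw [Polynomial.X_pow_dvd_iff]
  intro i hi
  have h := congrArg (Polynomial.coeff · i)
    (PowerSeries.trunc_mul_trunc (n := m) (P : R⟦X⟧) u)
  simp only [PowerSeries.coeff_trunc, if_pos hi] at h
  rw [Polynomial.coeff_sub, PowerSeries.coeff_trunc, if_pos hi, ← h, ← Polynomial.coe_mul,
    Polynomial.coeff_coe, sub_self]

theorem pow_dvd_sum_range_of_aeval_eq_zero {R S : Type*} [CommRing R] [CommRing S] [Algebra R S]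
    {P : R[X]} {x : S} (hx : Polynomial.aeval x P = 0) (u : R⟦X⟧) (m : ℕ) :
    x ^ m ∣ ∑ e ∈ Finset.range m, PowerSeries.coeff e ((P : R⟦X⟧) * u) • x ^ e := by
  have hsum : ∑ e ∈ Finset.range m, PowerSeries.coeff e ((P : R⟦X⟧) * u) • x ^ e =
      Polynomial.aeval x (PowerSeries.trunc m ((P : R⟦X⟧) * u)) := by
    rw [Polynomial.aeval_def, PowerSeries.eval₂_trunc_eq_sum_range]
    simp only [Algebra.smul_def]
  obtain ⟨Q, hQ⟩ := X_pow_dvd_trunc_mul_sub P u m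
  rw [hsum, sub_eq_iff_eq_add.1 hQ]
  simp [hx]

theorem hasSum_zero_of_aeval_eq_zero {R S : Type*} [CommRing R] [CommRing S] [Algebra R S]
    (J : Ideal S) {P : R[X]} {x : S} (hx : Polynomial.aeval x P = 0) {d : ℕ} (hd : x ^ d ∈ J)
    (u : R⟦X⟧) :
    letI : TopologicalSpace S := J.adicTopology
    HasSum (fun e : ℕ => PowerSeries.coeff e ((P : R⟦X⟧) * u) • x ^ e) 0 := by
  let : TopologicalSpace S := J.adicTopology
  refine J.hasBasis_nhds_zero_adic.tendsto_right_iff.2 fun N _ => ?_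
  have hpow : x ^ (d * N) ∈ J ^ N := pow_mul x d N ▸ Ideal.pow_mem_pow hd N
  filter_upwards [Filter.eventually_ge_atTop (Finset.range (d * N))] with T hT
  rw [← Finset.sum_sdiff hT]
  refine add_mem (Ideal.sum_mem _ fun e he => ?_)
    (Ideal.mem_of_dvd _ (pow_dvd_sum_range_of_aeval_eq_zero hx u _) hpow)
  have hle : d * N ≤ e := by simpa using (Finset.mem_sdiff.1 he).2
  rw [Algebra.smul_def]
  exact Ideal.mul_mem_left _ _ (Ideal.mem_of_dvd _ (pow_dvd_pow x hle) hpow)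

variable {O : Type*} [CommRing O] {K : Type*} [Field K] [Algebra O K] {F G : FormalGroup O}

theorem algebraMap_algebraicClosure_injective [IsFractionRing O K] :
    Function.Injective (algebraMap O (AlgebraicClosure K)) := by
  rw [IsScalarTower.algebraMap_eq O K (AlgebraicClosure K)]
  exact (algebraMap K _).injective.comp (IsFractionRing.injective O K)

theorem map_integralClosure_ne_top [IsLocalRing O] [IsFractionRing O K] :
    (maximalIdeal O).map (algebraMap O (integralClosure O (AlgebraicClosure K))) ≠ ⊤ := by
  have hinj : Function.Injective (algebraMap O (integralClosure O (AlgebraicClosure K))) :=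
    fun _ _ h => algebraMap_algebraicClosure_injective (congrArg Subtype.val h)
  rw [Ne, Ideal.map_eq_top_iff _ hinj (algebraMap_isIntegral_iff.2 inferInstance)]
  exact (maximalIdeal.isMaximal O).ne_top

theorem splits_of_kernelRational [IsDomain O] [IsLocalRing O] [IsAdicComplete (maximalIdeal O) O]
    [IsFractionRing O K] {f : Hom F G} (hK : f.KernelRational K) {P : O[X]} {u : O⟦X⟧}
    (hP : P.IsDistinguishedAt (maximalIdeal O)) (h : f.series = P * u) : P.Splits := by
  refine .of_splits_map_of_injective (algebraMap_algebraicClosure_injective (K := K))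
    (IsAlgClosed.splits _) fun x hx => ?_
  rw [Polynomial.mem_roots (hP.monic.map _).ne_zero, Polynomial.IsRoot.def,
    Polynomial.eval_map_algebraMap] at hx
  obtain ⟨z, rfl⟩ : ∃ z : integralClosure O (AlgebraicClosure K), z = x :=
    ⟨⟨x, P, hP.monic, hx⟩, rfl⟩
  have hz : Polynomial.aeval z P = 0 :=
    Subtype.ext ((Polynomial.aeval_algHom_apply (integralClosure O _).val z P).symm.trans hx)
  have hpow := hP.toIsWeaklyEisensteinAt.pow_natDegree_le_of_aeval_zero_of_monic_mem_map hz
    hP.monic P.natDegree (hP.monic.natDegree_map _).le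
  have hnonunit : z ∈ nonunits (integralClosure O (AlgebraicClosure K)) := fun hu =>
    map_integralClosure_ne_top (Ideal.eq_top_of_isUnit_mem _ hpow (hu.pow _))
  obtain ⟨y, -, hy⟩ := hK z ⟨hnonunit, h ▸ hasSum_zero_of_aeval_eq_zero _ hz hpow u⟩
  exact ⟨y, congrArg Subtype.val hy⟩

theorem card_ker_of_kernelRational [IsDomain O] [IsDiscreteValuationRing O]
    [IsAdicComplete (maximalIdeal O) O] [IsFractionRing O K] [CharZero O] {π : O}
    (hπ : Irreducible π) [F.IsComm] [G.IsComm] {f : Hom F G} {d : ℕ}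
    (hd : (f.series.map (residue O)).order = d) (hK : f.KernelRational K) :
    Nat.card f.onPoints.ker = d := by
  classical
  have hf : f.series ≠ 0 := by
    intro h0
    simp [h0] at hd
  obtain ⟨P, u, hP, hdP, hu, e⟩ := exists_weierstrass_of_order hd
  obtain ⟨r⟩ := nonempty_ker_equiv_roots hP hu e
  have hnodup := nodup_roots_of_linCoeff_ne_zero hπ (linCoeff_ne_zero hπ hf) hP e
  rw [Nat.card_congr r, Nat.card_eq_fintype_card, Fintype.card_coe,
    Multiset.toFinset_card_of_nodup hnodup,
    ← (splits_of_kernelRational hK hP e).natDegree_eq_card_roots, hdP]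

end Rational

/-! ### Artin–Schreier theory -/

section ArtinSchreier

theorem nonempty_quotient_range_equiv_ker {M N : Type*} [AddCommGroup M] [AddCommGroup N]
    {P D : M →+ M} {Q : N →+ N} (hcomm : ∀ x, P (D x) = D (P x)) (e : N ≃+ D.ker)
    (hQ : ∀ n, (e (Q n) : M) = P (e n)) (hP : Function.Surjective P) (hle : P.ker ≤ D.ker)
    (hD : P.ker ≤ D.range) : Nonempty (N ⧸ Q.range ≃+ P.ker) := by
  let A : AddSubgroup M := D.ker.comap P
  let f₁ : A →+ P.ker := (D.domRestrict A).codRestrict P.ker fun a => (hcomm a).trans a.2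
  let f₂ : A →+ N ⧸ Q.range := (QuotientAddGroup.mk' _).comp
    (e.symm.toAddMonoidHom.comp ((P.domRestrict A).codRestrict D.ker fun a => a.2))
  have h₁ : Function.Surjective f₁ := by
    rintro ⟨y, hy⟩
    obtain ⟨x, rfl⟩ := hD hy
    exact ⟨⟨x, (hcomm x).symm.trans hy⟩, rfl⟩
  have h₂ : Function.Surjective f₂ := by
    refine (QuotientAddGroup.mk'_surjective _).comp (e.symm.surjective.comp ?_)
    rintro ⟨y, hy⟩
    obtain ⟨x, rfl⟩ := hP y
    exact ⟨⟨x, hy⟩, rfl⟩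
  have hker : f₁.ker = f₂.ker := by
    ext a
    have hf₁ : a ∈ f₁.ker ↔ a.1 ∈ D.ker := Subtype.ext_iff
    have hf₂ : a ∈ f₂.ker ↔ ∃ n, Q n = e.symm ⟨P a, a.2⟩ := QuotientAddGroup.eq_zero_iff _
    rw [hf₁, hf₂]
    constructor
    · intro ha
      refine ⟨e.symm ⟨a, ha⟩, e.injective (Subtype.ext ?_)⟩
      rw [hQ, e.apply_symm_apply, e.apply_symm_apply]
    · rintro ⟨n, hn⟩
      rw [← add_sub_cancel (e n : M) a.1]
      refine add_mem (e n).2 (hle ?_)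
      rw [AddMonoidHom.mem_ker, map_sub, ← hQ, hn, e.apply_symm_apply, sub_self]
  exact ⟨(QuotientAddGroup.quotientKerEquivOfSurjective f₂ h₂).symm.trans
    ((QuotientAddGroup.quotientAddEquivOfEq hker.symm).trans
      (QuotientAddGroup.quotientKerEquivOfSurjective f₁ h₁))⟩

section Kernel

variable {L : Type*} [Field L] (p : ℕ) [hp : Fact p.Prime] [CharP L p] {a b ω : L}

theorem addCartierInv_apply (x : L) : addCartierInv p a b x = a * x + b * x ^ p := rfl

theorem addCartierInv_surjective [IsSepClosed L] (ha : a ≠ 0) :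
    Function.Surjective (addCartierInv p a b) := by
  intro c
  obtain ⟨x, hx⟩ := IsSepClosed.exists_root_C_mul_X_pow_add_C_mul_X_add_C' p p b a (-c) dvd_rfl
    hp.out.two_le ha
  exact ⟨x, by rw [addCartierInv_apply]; linear_combination hx⟩

theorem mem_ker_addCartierInv_iff (hb : b ≠ 0) (hω : ω ≠ 0) (h : addCartierInv p a b ω = 0)
    {x : L} : x ∈ (addCartierInv p a b).ker ↔ ∃ n : ZMod p, ZMod.castHom dvd_rfl L n * ω = x := by
  rw [addCartierInv_apply] at h
  have hfactor (z : L) : addCartierInv p a b (z * ω) = b * ω ^ p * (z ^ p - z) := by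
    rw [addCartierInv_apply, mul_pow]
    linear_combination z * h
  constructor
  · intro hx
    obtain ⟨z, rfl⟩ : ∃ z, z * ω = x := ⟨x / ω, div_mul_cancel₀ x hω⟩
    rw [AddMonoidHom.mem_ker, hfactor] at hx
    have hz : z ^ p = z := sub_eq_zero.1
      ((mul_eq_zero.1 hx).resolve_left (mul_ne_zero hb (pow_ne_zero p hω)))
    have hle : (⊥ : Subfield L) ≤ (ZMod.castHom (dvd_refl p) L).fieldRange := bot_le
    obtain ⟨n, rfl⟩ := hle ((Subfield.mem_bot_iff_pow_eq_self L p).2 hz)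
    exact ⟨n, rfl⟩
  · rintro ⟨n, rfl⟩
    rw [AddMonoidHom.mem_ker, hfactor, ← map_pow, ZMod.pow_card, sub_self, mul_zero]

theorem nonempty_ker_addCartierInv_equiv (hb : b ≠ 0) (hω : ω ≠ 0)
    (h : addCartierInv p a b ω = 0) : Nonempty ((addCartierInv p a b).ker ≃+ ZMod p) := by
  have hker {x : L} := mem_ker_addCartierInv_iff p hb hω h (x := x)
  let f : ZMod p →+ (addCartierInv p a b).ker :=
    ((AddMonoidHom.mulRight ω).comp (ZMod.castHom dvd_rfl L).toAddMonoidHom).codRestrict _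
      fun n => hker.2 ⟨n, rfl⟩
  refine ⟨(AddEquiv.ofBijective f ⟨fun m n hmn => ?_, fun x => ?_⟩).symm⟩
  · exact (ZMod.castHom dvd_rfl L).injective (mul_right_cancel₀ hω (congrArg Subtype.val hmn))
  · obtain ⟨n, hn⟩ := hker.1 x.2
    exact ⟨n, Subtype.ext hn⟩

end Kernel

theorem exists_apply_ne_zero_of_pow_apply_eq_zero {R M : Type*} [Semiring R] [AddCommMonoid M]
    [Module R M] {D : Module.End R M} {x : M} (hx : D x ≠ 0) {n : ℕ} (hn : (D ^ n) x = 0) :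
    ∃ y, D y ≠ 0 ∧ D (D y) = 0 := by
  induction n generalizing x with
  | zero =>
    rw [pow_zero, Module.End.one_apply] at hn
    exact absurd (by rw [hn, map_zero]) hx
  | succ n ih =>
    by_cases h : D (D x) = 0
    · exact ⟨x, hx, h⟩
    · exact ih h (by rwa [← Module.End.mul_apply, ← pow_succ])

variable {k L : Type*} [Field k] [Field L] [Algebra k L] (p : ℕ) [hp : Fact p.Prime]

-- `σ - 1` is nilpotent on the elements fixed by `σ ^ p`, as `(σ - 1) ^ p = σ ^ p - 1`.
theorem exists_apply_eq_add_one [CharP k p] {σ : L ≃ₐ[k] L}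
    (hσ : ∀ x, σ x = x → x ∈ (algebraMap k L).range) {x : L} (hx : σ x ≠ x)
    (hpx : (σ ^ p) x = x) : ∃ α, σ α = α + 1 := by
  let s : Module.End k L := σ.toLinearMap
  have hs (n : ℕ) (y : L) : (s ^ n) y = (σ ^ n) y := by
    rw [Module.End.pow_apply, AlgEquiv.coe_pow]
    rfl
  have := charP_of_injective_algebraMap (algebraMap k (Module.End k L)).injective p
  have hpow : ((s - 1) ^ p) x = 0 := by
    rw [sub_pow_char_of_commute _ (Commute.one_right s), one_pow, LinearMap.sub_apply, hs, hpx,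
      Module.End.one_apply, sub_self]
  obtain ⟨y, hy, hyy⟩ := exists_apply_ne_zero_of_pow_apply_eq_zero
    (D := s - 1) (x := x) (sub_ne_zero.2 hx) hpow
  obtain ⟨c, hc⟩ := hσ _ (sub_eq_zero.1 hyy)
  have hcy : σ y = y + algebraMap k L c := by
    rw [hc]
    exact (add_sub_cancel _ _).symm
  have hc0 : algebraMap k L c ≠ 0 := hc ▸ hy
  exact ⟨y / algebraMap k L c, by rw [map_div₀, hcy, AlgEquiv.commutes, add_div, div_self hc0]⟩

theorem algebraMap_addCartierInv [CharP k p] [CharP L p] {a b : k} (x : k) :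
    algebraMap k L (addCartierInv p a b x) =
      addCartierInv p (algebraMap k L a) (algebraMap k L b) (algebraMap k L x) := by
  simp only [addCartierInv_apply, map_add, map_mul, map_pow]

theorem ker_addCartierInv_le_range_algebraMap [CharP k p] [CharP L p] {a b ω : k} (hb : b ≠ 0)
    (hω : ω ≠ 0) (h : addCartierInv p a b ω = 0) :
    (addCartierInv p (algebraMap k L a) (algebraMap k L b)).ker ≤
      (algebraMap k L).toAddMonoidHom.range := by
  intro z hz
  obtain ⟨n, rfl⟩ := (mem_ker_addCartierInv_iff p ((map_ne_zero _).2 hb) ((map_ne_zero _).2 hω)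
    (by rw [← algebraMap_addCartierInv, h, map_zero])).1 hz
  refine ⟨ZMod.castHom dvd_rfl k n * ω, (map_mul (algebraMap k L) _ _).trans ?_⟩
  exact congrArg (· * algebraMap k L ω) (RingHom.congr_fun
    (Subsingleton.elim ((algebraMap k L).comp (ZMod.castHom dvd_rfl k)) (ZMod.castHom dvd_rfl L)) n)

-- Over `L` the map `P x = a x + b x ^ p` is surjective and commutes with `D = σ - 1`, whose kernel
-- is `k`; the snake lemma identifies `k / P k` with `ker P`.
theorem nonempty_quotient_range_addCartierInv_equiv_of_algEquiv [IsSepClosed L] [CharP k p]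
    {σ : L ≃ₐ[k] L} (hσ : ∀ x, σ x = x → x ∈ (algebraMap k L).range) {x : L} (hx : σ x ≠ x)
    (hpx : (σ ^ p) x = x) {a b ω : k} (ha : a ≠ 0) (hb : b ≠ 0) (hω : ω ≠ 0)
    (h : addCartierInv p a b ω = 0) : Nonempty (k ⧸ (addCartierInv p a b).range ≃+ ZMod p) := by
  have := charP_of_injective_algebraMap (algebraMap k L).injective p
  let i : k →+ L := (algebraMap k L).toAddMonoidHom
  let P : L →+ L := addCartierInv p (algebraMap k L a) (algebraMap k L b)
  let D : L →+ L := σ.toRingHom.toAddMonoidHom - AddMonoidHom.id L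
  have hD (z : L) : D z = σ z - z := rfl
  have hrange : i.range = D.ker := by
    ext z
    refine ⟨?_, fun hz => hσ z (sub_eq_zero.1 hz)⟩
    rintro ⟨z, rfl⟩
    exact sub_eq_zero.2 (σ.commutes z)
  have hcomm (z : L) : P (D z) = D (P z) := by
    simp only [P, hD, addCartierInv_apply, map_add, map_mul, map_pow, sub_pow_char,
      AlgEquiv.commutes]
    ring
  have hle : P.ker ≤ D.ker := hrange ▸ ker_addCartierInv_le_range_algebraMap p hb hω h
  have hDr : D.ker ≤ D.range := by
    obtain ⟨α, hα⟩ := exists_apply_eq_add_one p hσ hx hpx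
    intro z hz
    have hσz : σ z = z := sub_eq_zero.1 hz
    exact ⟨z * α, by rw [hD, map_mul, hα, hσz]; ring⟩
  let e : k ≃+ D.ker := (AddMonoidHom.ofInjective (f := i) (algebraMap k L).injective).trans
    (AddEquiv.addSubgroupCongr hrange)
  obtain ⟨e₁⟩ := nonempty_quotient_range_equiv_ker hcomm e (algebraMap_addCartierInv p)
    (addCartierInv_surjective p ((map_ne_zero _).2 ha)) hle (hle.trans hDr)
  obtain ⟨e₂⟩ := nonempty_ker_addCartierInv_equiv p (L := L) ((map_ne_zero _).2 hb)
    ((map_ne_zero _).2 hω) (by rw [← algebraMap_addCartierInv, h, map_zero])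
  exact ⟨e₁.trans e₂⟩

theorem mem_range_algebraMap_of_apply_eq_self [IsGalois k L] {σ : L ≃ₐ[k] L}
    (hσ : ∀ H : Subgroup (L ≃ₐ[k] L), IsClosed (H : Set (L ≃ₐ[k] L)) → σ ∈ H → H = ⊤) {x : L}
    (hx : σ x = x) : x ∈ (algebraMap k L).range := by
  have htop : MulAction.stabilizer (L ≃ₐ[k] L) x = ⊤ :=
    hσ _ (Subgroup.isClosed_of_isOpen _ (stabilizer_isOpen_of_isIntegral x)) hx
  exact (InfiniteGalois.mem_range_algebraMap_iff_fixed x).2 fun τ =>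
    MulAction.mem_stabilizer_iff.1 (htop ▸ Subgroup.mem_top τ)

theorem exists_notMem_range_algebraMap_of_isClosed [IsGalois k L] {H : Subgroup (L ≃ₐ[k] L)}
    (hH : IsClosed (H : Set (L ≃ₐ[k] L))) (hne : H ≠ ⊤) :
    ∃ x ∉ (algebraMap k L).range, ∀ τ ∈ H, τ x = x := by
  by_contra! hfix
  have hbot : IntermediateField.fixedField H = (⊥ : IntermediateField k L) := by
    refine eq_bot_iff.2 fun x hx => ?_
    by_contra hxk
    obtain ⟨τ, hτ, hτx⟩ := hfix x hxk
    exact hτx ((IntermediateField.mem_fixedField_iff H x).1 hx τ hτ)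
  have hfixing := InfiniteGalois.fixingSubgroup_fixedField (⟨H, hH⟩ : ClosedSubgroup (L ≃ₐ[k] L))
  rw [hbot, IntermediateField.fixingSubgroup_bot] at hfixing
  exact hne hfixing.symm

end ArtinSchreier

section QuasiFinite

open ProfiniteGrp.ProfiniteCompletion

theorem eq_top_of_isClosed_of_etaFn_mem
    {H : Subgroup (completion (GrpCat.of (Multiplicative ℤ)))}
    (hH : IsClosed (H : Set (completion (GrpCat.of (Multiplicative ℤ)))))
    (h : etaFn (GrpCat.of (Multiplicative ℤ)) (Multiplicative.ofAdd (1 : ℤ)) ∈ H) : H = ⊤ := by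
  let Γ := GrpCat.of (Multiplicative ℤ)
  let f : Multiplicative ℤ →* completion Γ := (eta Γ).hom
  have hf : f (Multiplicative.ofAdd 1) ∈ H := h
  have hrange : Set.range f ⊆ H := by
    rintro _ ⟨n, rfl⟩
    have hn : n = Multiplicative.ofAdd 1 ^ n.toAdd := by
      rw [← ofAdd_zsmul, smul_eq_mul, mul_one, ofAdd_toAdd]
    rw [hn, map_zpow]
    exact zpow_mem hf _
  exact eq_top_iff.2 fun x _ => hH.closure_subset_iff.2 hrange (denseRange Γ x)

theorem exists_isClosed_etaFn_pow_mem (p : ℕ) [hp : Fact p.Prime] :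
    ∃ H : Subgroup (completion (GrpCat.of (Multiplicative ℤ))),
      IsClosed (H : Set (completion (GrpCat.of (Multiplicative ℤ)))) ∧ H ≠ ⊤ ∧
      etaFn (GrpCat.of (Multiplicative ℤ)) (Multiplicative.ofAdd (1 : ℤ)) ^ p ∈ H := by
  let _ : TopologicalSpace (Multiplicative (ZMod p)) := ⊥
  have : DiscreteTopology (Multiplicative (ZMod p)) := ⟨rfl⟩
  let P : ProfiniteGrp.{0} := ProfiniteGrp.of (Multiplicative (ZMod p))
  let g₀ : Multiplicative ℤ →* Multiplicative (ZMod p) :=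
    AddMonoidHom.toMultiplicative (Int.castAddHom (ZMod p))
  let g : GrpCat.of (Multiplicative ℤ) ⟶ GrpCat.of P := GrpCat.ofHom g₀
  let γ := etaFn (GrpCat.of (Multiplicative ℤ)) (Multiplicative.ofAdd (1 : ℤ))
  let f : completion (GrpCat.of (Multiplicative ℤ)) →* Multiplicative (ZMod p) :=
    (lift g).hom.toMonoidHom
  have hf : f γ = Multiplicative.ofAdd ((1 : ℤ) : ZMod p) :=
    CategoryTheory.ConcreteCategory.congr_hom (lift_eta g) (Multiplicative.ofAdd (1 : ℤ))
  refine ⟨f.ker, ?_, fun htop => ?_, ?_⟩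
  · exact (isClosed_discrete {(1 : Multiplicative (ZMod p))}).preimage
      (lift g).hom.continuous_toFun
  · have hγ : γ ∈ f.ker := htop ▸ Subgroup.mem_top γ
    rw [MonoidHom.mem_ker, hf, Int.cast_one, ofAdd_eq_one] at hγ
    exact one_ne_zero hγ
  · change f (γ ^ p) = 1
    rw [map_pow, hf, ← ofAdd_nsmul, nsmul_eq_mul, CharP.cast_eq_zero, zero_mul, ofAdd_zero]

variable {k : Type*} [Field k] (p : ℕ) [hp : Fact p.Prime]

theorem exists_algEquiv_of_isQuasiFiniteField (hk : IsQuasiFiniteField k) :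
    ∃ σ : AlgebraicClosure k ≃ₐ[k] AlgebraicClosure k,
      (∀ x, σ x = x → x ∈ (algebraMap k (AlgebraicClosure k)).range) ∧
      ∃ x, σ x ≠ x ∧ (σ ^ p) x = x := by
  obtain ⟨_, ⟨e₀⟩⟩ := hk
  let Γ := AlgebraicClosure k ≃ₐ[k] AlgebraicClosure k
  let e : Γ ≃ₜ* completion (GrpCat.of (Multiplicative ℤ)) := e₀
  let γ := etaFn (GrpCat.of (Multiplicative ℤ)) (Multiplicative.ofAdd (1 : ℤ))
  have hfix (x : AlgebraicClosure k) :
      e.symm γ x = x → x ∈ (algebraMap k (AlgebraicClosure k)).range := by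
    refine mem_range_algebraMap_of_apply_eq_self fun H hH hγ => ?_
    have htop : H.comap e.symm.toMulEquiv.toMonoidHom = ⊤ :=
      eq_top_of_isClosed_of_etaFn_mem (hH.preimage e.symm.continuous_toFun) hγ
    refine eq_top_iff.2 fun τ _ => ?_
    have hτ : e.symm (e τ) ∈ H := Subgroup.mem_comap.1 (htop ▸ Subgroup.mem_top (e τ))
    rwa [e.symm_apply_apply] at hτ
  obtain ⟨H, hH, hne, hγ⟩ := exists_isClosed_etaFn_pow_mem p
  have hne' : H.comap e.toMulEquiv.toMonoidHom ≠ ⊤ := fun htop => hne <| by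
    refine eq_top_iff.2 fun x _ => ?_
    have hx : e (e.symm x) ∈ H := Subgroup.mem_comap.1 (htop ▸ Subgroup.mem_top (e.symm x))
    rwa [e.apply_symm_apply] at hx
  obtain ⟨x, hx, hHx⟩ := exists_notMem_range_algebraMap_of_isClosed
    (hH.preimage e.continuous_toFun : IsClosed (H.comap e.toMulEquiv.toMonoidHom : Set Γ)) hne'
  refine ⟨e.symm γ, hfix, x, fun h => hx (hfix x h), hHx _ ?_⟩
  change e (e.symm γ ^ p) ∈ H
  rwa [map_pow, e.apply_symm_apply]

theorem nonempty_quotient_range_addCartierInv_equiv [CharP k p] {a b ω : k}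
    (hk : IsQuasiFiniteField k) (ha : a ≠ 0) (hb : b ≠ 0) (hω : ω ≠ 0)
    (h : addCartierInv p a b ω = 0) : Nonempty (k ⧸ (addCartierInv p a b).range ≃+ ZMod p) := by
  obtain ⟨σ, hσ, x, hx, hpx⟩ := exists_algEquiv_of_isQuasiFiniteField p hk
  exact nonempty_quotient_range_addCartierInv_equiv_of_algEquiv p hσ hx hpx ha hb hω h

end QuasiFinite

/-! ### Chains of isogenies of height one -/

section Kernels

variable {A B C : Type*} [AddCommGroup A] [AddCommGroup B] [AddCommGroup C] (f : B →+ C)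
  (g : A →+ B)

theorem card_ker_comp_eq_mul :
    Nat.card (f.comp g).ker = Nat.card g.ker * Nat.card ↥(g.range ⊓ f.ker) := by
  have hle : g.ker ≤ (f.comp g).ker := fun x hx => by
    rw [AddMonoidHom.mem_ker, AddMonoidHom.comp_apply, AddMonoidHom.mem_ker.1 hx, map_zero]
  rw [← AddSubgroup.map_comap_eq, AddMonoidHom.comap_ker, ← AddSubgroup.relIndex_ker,
    ← Nat.card_congr (AddSubgroup.addSubgroupOfEquivOfLe hle).toEquiv]
  exact (AddSubgroup.card_mul_index _).symm

variable {f g}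

theorem card_ker_eq_of_card_ker_comp_eq_mul [Finite f.ker] {d e : ℕ} (hd : 0 < d) (he : 0 < e)
    (hf : Nat.card f.ker ≤ d) (hg : Nat.card g.ker ≤ e) (h : Nat.card (f.comp g).ker = d * e) :
    Nat.card f.ker = d ∧ Nat.card g.ker = e ∧ f.ker ≤ g.range := by
  have hinf : Nat.card ↥(g.range ⊓ f.ker) ≤ Nat.card f.ker :=
    Nat.card_le_card_of_injective _ (AddSubgroup.inclusion_injective inf_le_right)
  rw [card_ker_comp_eq_mul, mul_comm d] at h
  have hge : Nat.card g.ker = e := by nlinarith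
  have hinfd : Nat.card ↥(g.range ⊓ f.ker) = d := Nat.eq_of_mul_eq_mul_left he (hge ▸ h)
  have hfd : Nat.card f.ker = d := hf.antisymm (hinfd ▸ hinf)
  exact ⟨hfd, hge, inf_eq_right.1 (AddSubgroup.eq_of_le_of_card_ge inf_le_right (by omega))⟩

theorem isAddCyclic_ker_of_comp [IsAddCyclic (f.comp g).ker] (h : f.ker ≤ g.range) :
    IsAddCyclic f.ker := by
  refine isAddCyclic_of_surjective (G' := (f.comp g).ker) (g.addSubgroupComap f.ker) ?_
  rintro ⟨_, hy⟩
  obtain ⟨x, rfl⟩ := h hy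
  exact ⟨⟨x, hy⟩, rfl⟩

end Kernels

section Comp

variable {O : Type*} [CommRing O] [IsDomain O] [IsDiscreteValuationRing O]
  [IsAdicComplete (maximalIdeal O) O] {π : O} {p : ℕ} [hp : Fact p.Prime] {E F G H : FormalGroup O}
  [E.IsComm] [F.IsComm] [G.IsComm] [H.IsComm] {f : Hom G H} {g : Hom F G} {ψ : Hom E F}

theorem card_ker_onPoints_of_card_ker_comp {d e : ℕ} (hd : 0 < d) (he : 0 < e)
    (hf : (f.series.map (residue O)).order = d) (hg : (g.series.map (residue O)).order = e)
    (h : Nat.card (f.comp g).onPoints.ker = d * e) :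
    Nat.card f.onPoints.ker = d ∧ Nat.card g.onPoints.ker = e ∧
      f.onPoints.ker ≤ g.onPoints.range := by
  obtain ⟨_, hfd⟩ := finite_ker_of_order hf
  rw [onPoints_comp] at h
  exact card_ker_eq_of_card_ker_comp_eq_mul hd he hfd (finite_ker_of_order hg).2 h

theorem LeadingTermLaw.lt_mul_of_isAddCyclic_ker_comp [CharP (ResidueField O) p]
    (hπ : Irreducible π) {s s' : ℕ} {α β α' β' : ResidueField O}
    (hf : LeadingTermLaw π p f s α β) (hg : LeadingTermLaw π p g s' α' β')
    (hcyc : IsAddCyclic (f.comp g).onPoints.ker) (hcard : Nat.card (f.comp g).onPoints.ker = p ^ 2)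
    (hfcard : Nat.card f.onPoints.ker = p) : s < p * s' := by
  obtain ⟨⟨y, hy⟩, hgen⟩ := hcyc.exists_generator
  have hord := addOrderOf_eq_card_of_forall_mem_zmultiples hgen
  rw [hcard, AddSubgroup.addOrderOf_mk] at hord
  have hpy : p • y ≠ 0 := fun h => by
    have hdvd := addOrderOf_dvd_of_nsmul_eq_zero h
    rw [hord, ← pow_one p, ← pow_mul, Nat.pow_dvd_pow_iff_le_right hp.out.one_lt] at hdvd
    omega
  rw [onPoints_comp] at hy
  have hgy : g.onPoints y ∈ f.onPoints.ker := hy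
  have hker : p • y ∈ g.onPoints.ker := by
    have := card_nsmul_eq_zero' (x := (⟨_, hgy⟩ : f.onPoints.ker))
    rw [hfcard] at this
    rw [AddMonoidHom.mem_ker, map_nsmul]
    exact congrArg Subtype.val this
  have hnot := hg.onPoints_notMem_fil_of_prime_nsmul_mem_ker hπ hpy hker
  obtain ⟨ω, -, hω⟩ := hf.exists_of_mem_ker hgy fun h => hnot (h ▸ zero_mem _)
  by_contra! hle
  exact hnot (fil_anti G hle (hω.mem_pow hπ))

theorem lt_mul_of_isAddCyclic_ker_comp_comp [CharP (ResidueField O) p]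
    (hπ : Irreducible π) {s s' : ℕ} {α β α' β' : ResidueField O}
    (hf : LeadingTermLaw π p f s α β) (hg : LeadingTermLaw π p g s' α' β')
    (hcyc : IsAddCyclic (f.comp (g.comp ψ)).onPoints.ker)
    (hordf : (f.series.map (residue O)).order = p) (hordg : (g.series.map (residue O)).order = p)
    {e : ℕ} (he : 0 < e) (hψ : (ψ.series.map (residue O)).order = e)
    (hcard : Nat.card (f.comp (g.comp ψ)).onPoints.ker = p ^ 2 * e) :
    s < p * s' := by
  have hfg := order_map_residue_comp hordf hordg hp.out.ne_zero
  have hassoc : (f.comp (g.comp ψ)).onPoints = ((f.comp g).comp ψ).onPoints := by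
    simp only [onPoints_comp, AddMonoidHom.comp_assoc]
  rw [hassoc] at hcyc hcard
  rw [← sq] at hfg
  obtain ⟨hfgcard, -, hrange⟩ :=
    card_ker_onPoints_of_card_ker_comp (pow_pos hp.out.pos 2) he hfg hψ hcard
  rw [onPoints_comp] at hcyc
  obtain ⟨hfcard, -, -⟩ :=
    card_ker_onPoints_of_card_ker_comp hp.out.pos hp.out.pos hordf hordg (sq p ▸ hfgcard)
  exact hf.lt_mul_of_isAddCyclic_ker_comp hπ hg (isAddCyclic_ker_of_comp hrange) hfgcard hfcard

end Comp

section ChainComp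

variable {R : Type*} [CommRing R] {n : ℕ} {G : Fin (n + 1) → FormalGroup R}
  (φ : ∀ i : Fin n, Hom (G i.succ) (G i.castSucc))

theorem chainComp_last : chainComp φ (Fin.last n) = Hom.id _ := by
  rw [chainComp, Fin.reverseInduction_last]

theorem chainComp_castSucc (i : Fin n) :
    chainComp φ i.castSucc = (φ i).comp (chainComp φ i.succ) := by
  rw [chainComp, Fin.reverseInduction_castSucc]
  rfl

theorem pow_sub_castSucc (p : ℕ) (i : Fin n) :
    p ^ (n - (i.castSucc : ℕ)) = p * p ^ (n - (i.succ : ℕ)) := by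
  rw [← pow_succ', Fin.val_castSucc, Fin.val_succ, ← Nat.sub_sub,
    Nat.sub_add_cancel (Nat.sub_pos_of_lt i.2)]

theorem onPoints_ker_chainComp_le [IsLocalRing R] [IsAdicComplete (maximalIdeal R) R]
    [∀ i, (G i).IsComm] (j : Fin (n + 1)) :
    (chainComp φ j).onPoints.ker ≤ (chainComp φ 0).onPoints.ker := by
  induction j using Fin.induction with
  | zero => exact le_rfl
  | succ i ih =>
    refine le_trans (fun x hx => ?_) ih
    rw [AddMonoidHom.mem_ker] at hx ⊢
    rw [chainComp_castSucc, onPoints_comp, AddMonoidHom.comp_apply, hx, map_zero]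

end ChainComp

section ChainLaw

variable {O : Type*} [CommRing O] [IsDomain O] [IsDiscreteValuationRing O]
  {π : O} {p : ℕ} [hp : Fact p.Prime] {n : ℕ} {G : Fin (n + 1) → FormalGroup O}
  {φ : ∀ i : Fin n, Hom (G i.succ) (G i.castSucc)}

theorem order_map_residue_chainComp (hφ : ∀ i, ((φ i).series.map (residue O)).order = p)
    (j : Fin (n + 1)) :
    ((chainComp φ j).series.map (residue O)).order = (p ^ (n - (j : ℕ)) : ℕ) := by
  induction j using Fin.reverseInduction with
  | last =>
    rw [chainComp_last]
    change (PowerSeries.map (residue O) PowerSeries.X).order = _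
    simp
  | cast i ih =>
    rw [chainComp_castSucc, pow_sub_castSucc]
    exact order_map_residue_comp (hφ i) ih (pow_ne_zero _ hp.out.ne_zero)

variable [IsAdicComplete (maximalIdeal O) O] [∀ i, (G i).IsComm]

theorem card_ker_of_card_ker_chainComp (hφ : ∀ i, ((φ i).series.map (residue O)).order = p)
    {i : Fin n} (h : Nat.card (chainComp φ i.castSucc).onPoints.ker = p ^ (n - (i.castSucc : ℕ))) :
    Nat.card (φ i).onPoints.ker = p ∧
      Nat.card (chainComp φ i.succ).onPoints.ker = p ^ (n - (i.succ : ℕ)) ∧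
      (φ i).onPoints.ker ≤ (chainComp φ i.succ).onPoints.range := by
  rw [chainComp_castSucc, pow_sub_castSucc] at h
  exact card_ker_onPoints_of_card_ker_comp hp.out.pos (pow_pos hp.out.pos _) (hφ i)
    (order_map_residue_chainComp hφ i.succ) h

theorem card_ker_chainComp (hφ : ∀ i, ((φ i).series.map (residue O)).order = p)
    (h : Nat.card (chainComp φ 0).onPoints.ker = p ^ n) (j : Fin (n + 1)) :
    Nat.card (chainComp φ j).onPoints.ker = p ^ (n - (j : ℕ)) := by
  induction j using Fin.induction with
  | zero => exact h
  | succ i ih => exact (card_ker_of_card_ker_chainComp hφ ih).2.1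

/-- The leading term laws of a chain of isogenies of height one which holds together like a chain
with cyclic rational kernel: the kernel of each map lies in the image of the composite of the later
ones, and the breaks `p * s i` of consecutive laws do not interfere. -/
structure ChainLaw (π : O) (p : ℕ) (φ : ∀ i : Fin n, Hom (G i.succ) (G i.castSucc))
    (s : Fin n → ℕ) (α β : Fin n → ResidueField O) : Prop where
  law (i : Fin n) : LeadingTermLaw π p (φ i) (s i) (α i) (β i)
  ker_le_range (i : Fin n) : (φ i).onPoints.ker ≤ (chainComp φ i.succ).onPoints.range
  lt_mul {i i' : Fin n} (h : i.succ = i'.castSucc) : s i < p * s i'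

theorem lt_mul_of_isAddCyclic_ker_chainComp [CharP (ResidueField O) p] (hπ : Irreducible π)
    (hφ : ∀ i, ((φ i).series.map (residue O)).order = p)
    (hcard : Nat.card (chainComp φ 0).onPoints.ker = p ^ n)
    (hcyc : IsAddCyclic (chainComp φ 0).onPoints.ker) {s : Fin n → ℕ} {α β : Fin n → ResidueField O}
    (hlaw : ∀ i, LeadingTermLaw π p (φ i) (s i) (α i) (β i)) {i i' : Fin n}
    (h : i.succ = i'.castSucc) : s i < p * s i' := by
  have hcyci : IsAddCyclic (chainComp φ i.castSucc).onPoints.ker :=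
    isAddCyclic_of_injective (AddSubgroup.inclusion (onPoints_ker_chainComp_le φ i.castSucc))
      (AddSubgroup.inclusion_injective _)
  have hcardi := card_ker_chainComp hφ hcard i.castSucc
  rw [chainComp_castSucc] at hcyci hcardi
  rw [pow_sub_castSucc] at hcardi
  have key (j : Fin (n + 1)) (hj : j = i'.castSucc) (f : Hom (G j) (G i.castSucc))
      (hf : LeadingTermLaw π p f (s i) (α i) (β i))
      (hordf : (f.series.map (residue O)).order = p)
      (hcyc : IsAddCyclic (f.comp (chainComp φ j)).onPoints.ker)
      (hcard : Nat.card (f.comp (chainComp φ j)).onPoints.ker = p * p ^ (n - (j : ℕ))) :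
      s i < p * s i' := by
    subst hj
    rw [chainComp_castSucc] at hcyc hcard
    rw [pow_sub_castSucc, ← mul_assoc, ← sq] at hcard
    exact lt_mul_of_isAddCyclic_ker_comp_comp hπ hf (hlaw i') hcyc hordf (hφ i')
      (pow_pos hp.out.pos _) (order_map_residue_chainComp hφ i'.succ) hcard
  exact key i.succ h (φ i) (hlaw i) (hφ i) hcyci hcardi

theorem exists_chainLaw [CharP (ResidueField O) p] (hπ : Irreducible π)
    (hφ : ∀ i, ((φ i).series.map (residue O)).order = p)
    (hcard : Nat.card (chainComp φ 0).onPoints.ker = p ^ n)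
    (hcyc : IsAddCyclic (chainComp φ 0).onPoints.ker) : ∃ s α β, ChainLaw π p φ s α β := by
  have hker (i : Fin n) :=
    card_ker_of_card_ker_chainComp (i := i) hφ (card_ker_chainComp hφ hcard i.castSucc)
  choose s α β hlaw using fun i => exists_leadingTermLaw hπ (hφ i) (hker i).1
  exact ⟨s, α, β, hlaw, fun i => (hker i).2.2,
    lt_mul_of_isAddCyclic_ker_chainComp hπ hφ hcard hcyc hlaw⟩

end ChainLaw

section ChainSum

variable {O : Type*} [CommRing O] [IsDomain O] [IsDiscreteValuationRing O] {n : ℕ}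
  {G : Fin (n + 1) → FormalGroup O}

/-- The sum `t_1 + ⋯ + t_j`. -/
def chainSum (φ : ∀ i : Fin n, Hom (G i.succ) (G i.castSucc)) (j : Fin (n + 1)) : ℕ :=
  ∑ l with l.castSucc < j, chainT φ l

/-- The integers `c_0 = 0` and `c_i = t_1 + ⋯ + t_i + s_i`; they agree with `chainC` because
`s_i = t_i / (p - 1)`. -/
def chainBreak (φ : ∀ i : Fin n, Hom (G i.succ) (G i.castSucc)) (s : Fin n → ℕ)
    (j : Fin (n + 1)) : ℕ :=
  Fin.cases 0 (fun i => chainSum φ i.succ + s i) j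

variable (φ : ∀ i : Fin n, Hom (G i.succ) (G i.castSucc))

theorem chainSum_zero : chainSum φ 0 = 0 := by
  simp [chainSum]

theorem chainSum_castSucc (i : Fin n) :
    chainSum φ i.castSucc = ∑ l ∈ Finset.Iio i, chainT φ l := by
  refine Finset.sum_congr ?_ fun _ _ => rfl
  ext l
  simp

theorem chainSum_succ_eq_sum (i : Fin n) : chainSum φ i.succ = ∑ l ∈ Finset.Iic i, chainT φ l := by
  refine Finset.sum_congr ?_ fun _ _ => rfl
  ext l
  simp [Fin.castSucc_lt_succ_iff]

theorem chainSum_succ (i : Fin n) :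
    chainSum φ i.succ = chainSum φ i.castSucc + chainT φ i := by
  rw [chainSum_succ_eq_sum, chainSum_castSucc, ← Finset.Iio_insert,
    Finset.sum_insert Finset.notMem_Iio_self, add_comm]

end ChainSum

section GradedPieces

variable {O : Type*} [CommRing O] [IsDomain O] [IsDiscreteValuationRing O]
  [IsAdicComplete (maximalIdeal O) O] {π : O} {p : ℕ}

namespace LeadingTermLaw

variable [hp : Fact p.Prime] {F G H : FormalGroup O} [F.IsComm] [G.IsComm] [H.IsComm]
  {f : Hom G H} {s : ℕ} {α β : ResidueField O}

theorem leadGroup_comp_eq_top [CharP (ResidueField O) p] [PerfectField (ResidueField O)]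
    (hπ : Irreducible π) (h : LeadingTermLaw π p f s α β) (ψ : Hom F G) {r : ℕ} (hr : r ≠ 0)
    (hrs : r < s) (htop : leadGroup hπ ψ r = ⊤) : leadGroup hπ (f.comp ψ) (p * r) = ⊤ := by
  refine eq_top_iff.2 fun c _ => ?_
  rcases eq_or_ne c 0 with rfl | hc
  · exact zero_mem _
  obtain ⟨ξ, hξ⟩ := surjective_frobenius (ResidueField O) p (β⁻¹ * c)
  refine (h.mem_leadGroup_low hπ ψ (Nat.mul_lt_mul_of_pos_left hrs hp.out.pos) hc).2
    ⟨r, rfl, hr, ξ, htop ▸ AddSubgroup.mem_top ξ, ?_⟩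
  rw [← frobenius_def, hξ, mul_inv_cancel_left₀ h.top_ne_zero]

theorem leadGroup_comp_eq_bot (hπ : Irreducible π) (h : LeadingTermLaw π p f s α β) (ψ : Hom F G)
    {m : ℕ} (hm : m < p * s) (hbot : ∀ r ≠ 0, m = p * r → leadGroup hπ ψ r = ⊥) :
    leadGroup hπ (f.comp ψ) m = ⊥ := by
  refine eq_bot_iff.2 fun c hc => ?_
  by_contra hc0
  obtain ⟨r, hmr, hr, ξ, hξ, hcξ⟩ := (h.mem_leadGroup_low hπ ψ hm hc0).1 hc
  rw [hbot r hr hmr, AddSubgroup.mem_bot] at hξ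
  rw [hξ, zero_pow hp.out.ne_zero, mul_zero] at hcξ
  exact hc0 hcξ

end LeadingTermLaw

namespace ChainLaw

variable {n : ℕ} {G : Fin (n + 1) → FormalGroup O} [∀ i, (G i).IsComm]
  {φ : ∀ i : Fin n, Hom (G i.succ) (G i.castSucc)} {s : Fin n → ℕ} {α β : Fin n → ResidueField O}

theorem chainT_eq (hπ : Irreducible π) (h : ChainLaw π p φ s α β) (i : Fin n) :
    chainT φ i = (p - 1) * s i :=
  (h.law i).linCoeff.toNat_addVal hπ (h.law i).lin_ne_zero

theorem lt_mul_of_castSucc_eq_succ (h : ChainLaw π p φ s α β) {i : Fin n} {r : ℕ}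
    (hr : r ≤ s i) (i' : Fin n) (hi' : i'.castSucc = i.succ) : r < p * s i' :=
  hr.trans_lt (h.lt_mul hi'.symm)

theorem exists_linCoeff_eq (hπ : Irreducible π) (h : ChainLaw π p φ s α β) (i : Fin n) :
    ∃ u, (φ i).linCoeff = u * π ^ chainT φ i ∧ residue O u = α i := by
  obtain ⟨u, hu, hα⟩ := (h.law i).linCoeff
  exact ⟨u, by rw [hu, h.chainT_eq hπ, mul_comm], hα⟩

variable [hp : Fact p.Prime]

theorem mul_eq_chainT_add (hπ : Irreducible π) (h : ChainLaw π p φ s α β) (i : Fin n) :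
    p * s i = chainT φ i + s i := by
  rw [h.chainT_eq hπ, mul_eq_add_pred_mul hp.out.one_le, add_comm]

theorem chainT_div (hπ : Irreducible π) (h : ChainLaw π p φ s α β) (i : Fin n) :
    (chainT φ i : ℚ) / ((p : ℚ) - 1) = s i := by
  have hp1 : (p : ℚ) - 1 ≠ 0 := sub_ne_zero.2 (mod_cast hp.out.one_lt.ne')
  rw [h.chainT_eq hπ, Nat.cast_mul, Nat.cast_pred hp.out.pos, mul_div_cancel_left₀ _ hp1]

theorem mul_eq_mul_chainT_div (hπ : Irreducible π) (h : ChainLaw π p φ s α β) (i : Fin n) :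
    ((p * s i : ℕ) : ℚ) = p * chainT φ i / ((p : ℚ) - 1) := by
  rw [mul_div_assoc, h.chainT_div hπ, Nat.cast_mul]

theorem chainC_eq (hπ : Irreducible π) (h : ChainLaw π p φ s α β) (j : Fin (n + 1)) :
    chainC p φ j = chainBreak φ s j := by
  refine Fin.cases ?_ (fun i => ?_) j
  · simp [chainC, chainBreak]
  · simp only [chainC, chainBreak, Fin.cases_succ]
    rw [h.chainT_div hπ, chainSum_succ_eq_sum]
    push_cast
    rfl

theorem chainBreak_succ (hπ : Irreducible π) (h : ChainLaw π p φ s α β) (i : Fin n) :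
    chainBreak φ s i.succ = chainSum φ i.castSucc + p * s i := by
  rw [h.mul_eq_chainT_add hπ, ← add_assoc, ← chainSum_succ]
  rfl

theorem strictMono_chainBreak (hπ : Irreducible π) (h : ChainLaw π p φ s α β) :
    StrictMono (chainBreak φ s) := by
  refine Fin.strictMono_iff_lt_succ.2 fun i => ?_
  rw [h.chainBreak_succ hπ]
  rcases Fin.eq_zero_or_eq_succ i.castSucc with h0 | ⟨l, hl⟩
  · rw [h0]
    exact Nat.add_pos_right _ (Nat.mul_pos hp.out.pos (Nat.pos_of_ne_zero (h.law i).ne_zero))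
  · rw [hl]
    exact Nat.add_lt_add_left (h.lt_mul hl.symm) _

theorem leadGroup_eq_top [CharP (ResidueField O) p] [PerfectField (ResidueField O)]
    (hπ : Irreducible π) (h : ChainLaw π p φ s α β) {j : Fin (n + 1)} {r : ℕ} (hr : r ≠ 0)
    (hrs : ∀ i, i.castSucc = j → r < p * s i) (hd : p ^ (n - (j : ℕ)) ∣ r) :
    leadGroup hπ (chainComp φ j) r = ⊤ := by
  induction j using Fin.reverseInduction generalizing r with
  | last =>
    rw [chainComp_last, eq_top_iff]
    intro c _
    obtain ⟨x, hx⟩ := exists_point_hasLeadingTerm hπ (G (Fin.last n)) hr c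
    exact mem_leadGroup.2 ⟨x, by rwa [onPoints_id]⟩
  | cast i ih =>
    obtain ⟨q, rfl⟩ := hd
    rw [pow_sub_castSucc, mul_assoc] at hr hrs ⊢
    have hr' := right_ne_zero_of_mul hr
    have hrs' := Nat.lt_of_mul_lt_mul_left (hrs i rfl)
    rw [chainComp_castSucc]
    exact (h.law i).leadGroup_comp_eq_top hπ _ hr' hrs'
      (ih hr' (h.lt_mul_of_castSucc_eq_succ hrs'.le) (dvd_mul_right _ _))

theorem leadGroup_eq_bot (hπ : Irreducible π) (h : ChainLaw π p φ s α β) {j : Fin (n + 1)} {r : ℕ}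
    (hrs : ∀ i, i.castSucc = j → r < p * s i) (hd : ¬ p ^ (n - (j : ℕ)) ∣ r) :
    leadGroup hπ (chainComp φ j) r = ⊥ := by
  induction j using Fin.reverseInduction generalizing r with
  | last => simp at hd
  | cast i ih =>
    rw [pow_sub_castSucc] at hd
    rw [chainComp_castSucc]
    refine (h.law i).leadGroup_comp_eq_bot hπ _ (hrs i rfl) ?_
    rintro r' - rfl
    exact ih (h.lt_mul_of_castSucc_eq_succ (Nat.lt_of_mul_lt_mul_left (hrs i rfl)).le)
      fun hd' => hd (Nat.mul_dvd_mul_left p hd')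

theorem pow_dvd (hπ : Irreducible π) (h : ChainLaw π p φ s α β) (i : Fin n) :
    p ^ (n - (i.succ : ℕ)) ∣ s i := by
  by_contra hd
  obtain ⟨ω, hω0, hω⟩ := (h.law i).exists_root
  obtain ⟨w, hw, hwω⟩ := (h.law i).exists_mem_ker hω
  obtain ⟨x, rfl⟩ := h.ker_le_range i hw
  have hmem : ω ∈ leadGroup hπ (chainComp φ i.succ) (s i) := mem_leadGroup.2 ⟨x, hwω⟩
  rw [h.leadGroup_eq_bot hπ (h.lt_mul_of_castSucc_eq_succ le_rfl) hd, AddSubgroup.mem_bot] at hmem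
  exact hω0 hmem

theorem leadGroup_mul_eq_range [CharP (ResidueField O) p] [PerfectField (ResidueField O)]
    (hπ : Irreducible π) (h : ChainLaw π p φ s α β) (i : Fin n) :
    leadGroup hπ (chainComp φ i.castSucc) (p * s i) = (addCartierInv p (α i) (β i)).range := by
  have htop := h.leadGroup_eq_top hπ (h.law i).ne_zero (h.lt_mul_of_castSucc_eq_succ le_rfl)
    (h.pow_dvd hπ i)
  ext c
  rw [chainComp_castSucc, (h.law i).mem_leadGroup_mid hπ, htop]
  simp only [AddSubgroup.mem_top, true_and, AddMonoidHom.mem_range, addCartierInv_apply, eq_comm]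

theorem pow_dvd_chainSum (hπ : Irreducible π) (h : ChainLaw π p φ s α β) (i : Fin n) :
    p ^ (n - (i : ℕ)) ∣ chainSum φ i.castSucc := by
  rw [chainSum_castSucc]
  refine Finset.dvd_sum fun l hl => ?_
  rw [h.chainT_eq hπ]
  have hli : (l.succ : ℕ) ≤ i := Fin.lt_def.1 (Finset.mem_Iio.1 hl)
  exact ((pow_dvd_pow p (Nat.sub_le_sub_left hli n)).trans (h.pow_dvd hπ l)).mul_left _

theorem nonempty_gr_equiv_gr (hπ : Irreducible π) (h : ChainLaw π p φ s α β) (i : Fin n) {r : ℕ}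
    (hr : s i < r) :
    Nonempty ((chainComp φ i.castSucc).gr (r + chainT φ i) ≃+ (chainComp φ i.succ).gr r) := by
  have hr0 : r ≠ 0 := hr.ne_bot
  rw [chainComp_castSucc, h.chainT_eq hπ]
  exact FormalIsogeny.nonempty_gr_equiv_gr hπ _ _ (by omega) hr0 (h.law i).lin_ne_zero
    ((h.law i).mem_leadGroup_high hπ _ (h.ker_le_range i) hr)

theorem exists_gr_equiv_gr (hπ : Irreducible π) (h : ChainLaw π p φ s α β) (j : Fin (n + 1)) {m : ℕ}
    (hm : chainBreak φ s j < m) :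
    ∃ r ≠ 0, m = chainSum φ j + r ∧ Nonempty ((chainComp φ 0).gr m ≃+ (chainComp φ j).gr r) := by
  induction j using Fin.induction with
  | zero => exact ⟨m, hm.ne_bot, by rw [chainSum_zero, _root_.zero_add], ⟨AddEquiv.refl _⟩⟩
  | succ i ih =>
    obtain ⟨r, hr, rfl, ⟨e⟩⟩ := ih ((h.strictMono_chainBreak hπ i.castSucc_lt_succ).trans hm)
    rw [h.chainBreak_succ hπ, h.mul_eq_chainT_add hπ, Nat.add_lt_add_iff_left] at hm
    obtain ⟨r, rfl⟩ := Nat.exists_eq_add_of_le' (Nat.le_of_add_right_le hm.le)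
    have hsr : s i < r := by omega
    obtain ⟨e'⟩ := h.nonempty_gr_equiv_gr hπ i hsr
    exact ⟨r, hsr.ne_bot, by rw [chainSum_succ]; omega, ⟨e.trans e'⟩⟩

theorem fil_le_range (hπ : Irreducible π) (h : ChainLaw π p φ s α β) (j : Fin (n + 1)) {r : ℕ}
    (hr : chainBreak φ s (Fin.last n) < chainSum φ j + r) :
    (G j).fil r ≤ (chainComp φ j).onPoints.range := by
  induction j using Fin.reverseInduction generalizing r with
  | last =>
    rw [chainComp_last, onPoints_id]
    exact fun z _ => ⟨z, rfl⟩
  | cast i ih =>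
    intro z hz
    have hle := (h.strictMono_chainBreak hπ).monotone (Fin.le_last i.succ)
    have hbr := hle.trans_lt hr
    rw [h.chainBreak_succ hπ, h.mul_eq_chainT_add hπ, Nat.add_lt_add_iff_left] at hbr
    obtain ⟨r, rfl⟩ := Nat.exists_eq_add_of_le' (Nat.le_of_add_right_le hbr.le)
    have hsr : s i < r := by omega
    rw [h.chainT_eq hπ] at hz
    obtain ⟨x, hx, rfl⟩ := (h.law i).exists_onPoints_eq hπ hsr hz
    obtain ⟨y, rfl⟩ := ih (by rw [chainSum_succ]; omega) hx
    exact ⟨y, by rw [chainComp_castSucc, onPoints_comp]; rfl⟩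

theorem nonempty_gr_equiv_residueField (hπ : Irreducible π) (h : ChainLaw π p φ s α β) {i : Fin n}
    {m : ℕ} (hm : chainBreak φ s i.castSucc < m) (hm' : m < chainBreak φ s i.succ)
    (hd : ¬ p ^ (n - (i : ℕ)) ∣ m) : Nonempty ((chainComp φ 0).gr m ≃+ ResidueField O) := by
  obtain ⟨r, hr, rfl, ⟨e⟩⟩ := h.exists_gr_equiv_gr hπ i.castSucc hm
  rw [h.chainBreak_succ hπ, Nat.add_lt_add_iff_left] at hm'
  rw [Nat.dvd_add_right (h.pow_dvd_chainSum hπ i)] at hd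
  obtain ⟨e'⟩ := FormalIsogeny.nonempty_gr_equiv_residueField hπ _ hr <|
    h.leadGroup_eq_bot hπ (fun _ hi => Fin.castSucc_injective n hi ▸ hm') hd
  exact ⟨e.trans e'⟩

theorem subsingleton_gr [CharP (ResidueField O) p] [PerfectField (ResidueField O)]
    (hπ : Irreducible π) (h : ChainLaw π p φ s α β) {i : Fin n} {m : ℕ}
    (hm : chainBreak φ s i.castSucc < m) (hm' : m < chainBreak φ s i.succ)
    (hd : p ^ (n - (i : ℕ)) ∣ m) : Subsingleton ((chainComp φ 0).gr m) := by
  obtain ⟨r, hr, rfl, ⟨e⟩⟩ := h.exists_gr_equiv_gr hπ i.castSucc hm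
  rw [h.chainBreak_succ hπ, Nat.add_lt_add_iff_left] at hm'
  rw [Nat.dvd_add_right (h.pow_dvd_chainSum hπ i)] at hd
  have := subsingleton_gr_of_leadGroup_eq_top hπ _ hr <|
    h.leadGroup_eq_top hπ hr (fun _ hi => Fin.castSucc_injective n hi ▸ hm') hd
  exact e.toEquiv.subsingleton

theorem nonempty_gr_chainBreak_equiv_gr (hπ : Irreducible π) (h : ChainLaw π p φ s α β)
    (i : Fin n) : Nonempty
      ((chainComp φ 0).gr (chainBreak φ s i.succ) ≃+ (chainComp φ i.castSucc).gr (p * s i)) := by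
  obtain ⟨r, -, hr, e⟩ :=
    h.exists_gr_equiv_gr hπ i.castSucc (h.strictMono_chainBreak hπ i.castSucc_lt_succ)
  rw [h.chainBreak_succ hπ, Nat.add_left_cancel_iff] at hr
  exact hr ▸ e

theorem nonempty_gr_chainBreak_equiv_quotient [CharP (ResidueField O) p]
    [PerfectField (ResidueField O)] (hπ : Irreducible π) (h : ChainLaw π p φ s α β) (i : Fin n) :
    Nonempty ((chainComp φ 0).gr (chainBreak φ s i.succ) ≃+
      ResidueField O ⧸ (addCartierInv p (α i) (β i)).range) := by
  obtain ⟨e⟩ := h.nonempty_gr_chainBreak_equiv_gr hπ i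
  obtain ⟨e'⟩ := nonempty_gr_equiv hπ (chainComp φ i.castSucc)
    (mul_ne_zero hp.out.ne_zero (h.law i).ne_zero)
  exact ⟨(e.trans e').trans
    (QuotientAddGroup.quotientAddEquivOfEq (h.leadGroup_mul_eq_range hπ i))⟩

theorem subsingleton_gr_chainBreak [CharP (ResidueField O) p] [PerfectField (ResidueField O)]
    [IsSepClosed (ResidueField O)] (hπ : Irreducible π) (h : ChainLaw π p φ s α β) (i : Fin n) :
    Subsingleton ((chainComp φ 0).gr (chainBreak φ s i.succ)) := by
  obtain ⟨e⟩ := h.nonempty_gr_chainBreak_equiv_quotient hπ i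
  have hsurj := addCartierInv_surjective p (b := β i) (h.law i).lin_ne_zero
  have : Subsingleton (ResidueField O ⧸ (addCartierInv p (α i) (β i)).range) := by
    rw [AddMonoidHom.range_eq_top.2 hsurj]
    exact QuotientAddGroup.subsingleton_quotient_top
  exact e.toEquiv.subsingleton

theorem nonempty_gr_chainBreak_equiv_zmod [CharP (ResidueField O) p]
    (hk : IsQuasiFiniteField (ResidueField O)) (hπ : Irreducible π) (h : ChainLaw π p φ s α β)
    (i : Fin n) : Nonempty ((chainComp φ 0).gr (chainBreak φ s i.succ) ≃+ ZMod p) := by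
  have := hk.1
  obtain ⟨e⟩ := h.nonempty_gr_chainBreak_equiv_quotient hπ i
  obtain ⟨ω, hω0, hω⟩ := (h.law i).exists_root
  obtain ⟨e'⟩ := nonempty_quotient_range_addCartierInv_equiv p hk (h.law i).lin_ne_zero
    (h.law i).top_ne_zero hω0 hω
  exact ⟨e.trans e'⟩

theorem cokerFil_eq_bot (hπ : Irreducible π) (h : ChainLaw π p φ s α β) {m : ℕ}
    (hm : chainBreak φ s (Fin.last n) < m) : (chainComp φ 0).cokerFil m = ⊥ :=
  FormalIsogeny.cokerFil_eq_bot _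
    (h.fil_le_range hπ 0 (by rwa [chainSum_zero, _root_.zero_add]))

end ChainLaw

theorem exists_chainLaw_of_kernelRational [CharP (ResidueField O) p] {K : Type*} [Field K]
    [CharZero K] [Algebra O K] [IsFractionRing O K] [hp : Fact p.Prime] (hπ : Irreducible π) {n : ℕ}
    {G : Fin (n + 1) → FormalGroup O} [∀ i, (G i).IsComm]
    {φ : ∀ i : Fin n, Hom (G i.succ) (G i.castSucc)} (hφ : ∀ i, (φ i).HasHeight p 1)
    (hK : (chainComp φ 0).KernelRational K) (hcyc : IsAddCyclic (chainComp φ 0).onPoints.ker) :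
    ∃ s α β, ChainLaw π p φ s α β := by
  have : CharZero O := (algebraMap O K).charZero
  have hord (i : Fin n) := order_map_residue_of_hasHeight hp.out.ne_zero (hφ i)
  exact exists_chainLaw hπ hord
    (card_ker_of_kernelRational hπ (order_map_residue_chainComp hord 0) hK) hcyc

end GradedPieces

end FormalIsogeny

end

theorem proposition2p8 {O K : Type*} [CommRing O] [IsDomain O] [IsDiscreteValuationRing O]
    [IsAdicComplete (IsLocalRing.maximalIdeal O) O]
    [Field K] [CharZero K] [Algebra O K] [IsFractionRing O K]
    (p : ℕ) [Fact p.Prime] [CharP (IsLocalRing.ResidueField O) p]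
    [PerfectField (IsLocalRing.ResidueField O)]
    (π : O) (hπ : Irreducible π)
    {n : ℕ} (hn : 1 ≤ n)
    -- `F = G (Fin.last n)`, and `φ i : G_{i+1} → G_i` is the isogeny `φ_{i+1}`
    (G : Fin (n + 1) → FormalGroup O) [∀ i, (G i).IsComm]
    (φ : ∀ i : Fin n, FormalGroup.Hom (G i.succ) (G i.castSucc))
    (hφ : ∀ i, (φ i).HasHeight p 1)
    (hK : (FormalGroup.chainComp φ 0).KernelRational K)
    (hcyc : IsAddCyclic (FormalGroup.chainComp φ 0).onPoints.ker) :
    -- (i)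
    (∀ (i : Fin n) (m : ℕ),
      FormalGroup.chainC p φ i.castSucc < m → (m : ℚ) < FormalGroup.chainC p φ i.succ →
        (∃ r : ℕ, m = (∑ l ∈ Finset.Iio i, FormalGroup.chainT φ l) + r ∧
          Nonempty ((FormalGroup.chainComp φ 0).gr m ≃+
            (FormalGroup.chainComp φ i.castSucc).gr r)) ∧
        (¬ p ^ (n - (i : ℕ)) ∣ m →
          Nonempty ((FormalGroup.chainComp φ 0).gr m ≃+ IsLocalRing.ResidueField O)) ∧
        (p ^ (n - (i : ℕ)) ∣ m → Subsingleton ((FormalGroup.chainComp φ 0).gr m))) ∧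
    -- (ii)
    (∀ i : Fin n, ∃ m r : ℕ,
      (m : ℚ) = FormalGroup.chainC p φ i.succ ∧
      (r : ℚ) = p * FormalGroup.chainT φ i / ((p : ℚ) - 1) ∧
      Nonempty ((FormalGroup.chainComp φ 0).gr m ≃+
        (FormalGroup.chainComp φ i.castSucc).gr r) ∧
      (∃ u : O, (φ i).linCoeff = u * π ^ FormalGroup.chainT φ i ∧
        Nonempty ((FormalGroup.chainComp φ 0).gr m ≃+
          IsLocalRing.ResidueField O ⧸
            (addCartierInv p (IsLocalRing.residue O u)
              (IsLocalRing.residue O (PowerSeries.coeff p (φ i).series))).range)) ∧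
      (IsSepClosed (IsLocalRing.ResidueField O) →
        Subsingleton ((FormalGroup.chainComp φ 0).gr m)) ∧
      (IsQuasiFiniteField (IsLocalRing.ResidueField O) →
        Nonempty ((FormalGroup.chainComp φ 0).gr m ≃+ ZMod p))) ∧
    -- (iii)
    (∀ m : ℕ, FormalGroup.chainC p φ (Fin.last n) < m →
      (FormalGroup.chainComp φ 0).cokerFil m = ⊥ ∧
      Subsingleton ((FormalGroup.chainComp φ 0).gr m)) := by
  obtain ⟨s, α, β, h⟩ := FormalIsogeny.exists_chainLaw_of_kernelRational hπ hφ hK hcyc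
  simp only [h.chainC_eq hπ, Nat.cast_lt, Nat.cast_inj]
  refine ⟨fun i m hm hm' => ⟨?_, ?_, ?_⟩, fun i => ⟨_, p * s i, rfl, ?_, ?_, ?_, ?_, ?_⟩,
    fun m hm => ?_⟩
  · obtain ⟨r, -, hr, e⟩ := h.exists_gr_equiv_gr hπ i.castSucc hm
    exact ⟨r, by rwa [← FormalIsogeny.chainSum_castSucc], e⟩
  · exact h.nonempty_gr_equiv_residueField hπ hm hm'
  · exact h.subsingleton_gr hπ hm hm'
  · exact h.mul_eq_mul_chainT_div hπ i
  · exact h.nonempty_gr_chainBreak_equiv_gr hπ i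
  · obtain ⟨u, hu, hα⟩ := h.exists_linCoeff_eq hπ i
    rw [(h.law i).residue_coeff]
    exact ⟨u, hu, hα ▸ h.nonempty_gr_chainBreak_equiv_quotient hπ i⟩
  · exact fun _ => h.subsingleton_gr_chainBreak hπ i
  · exact fun hk => h.nonempty_gr_chainBreak_equiv_zmod hk hπ i
  · have hbot := h.cokerFil_eq_bot hπ hm
    exact ⟨hbot, FormalIsogeny.subsingleton_gr_of_cokerFil_eq_bot _ hbot⟩
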